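/- Let $n\ge 1$ and let $f=f_0x_1^n+f_1x_1^{n-1}x_2+\dots+f_nx_2^n$ be a non-zero binary $n$-ic form with coefficients in $\mathbb Z$. Let $T_f\subset\mathbb P^1_{\mathbb Z}$ be the closed subscheme cut out by $f$, let $R_f=\Gamma(T_f,\mathcal O_{T_f})$ and let $I_f$ be the $R_f$-module $\Gamma(T_f,\mathcal O_{T_f}(n-3))$. Let $I_f\to V=\mathbb Z^2$ be the canonical homomorphism of abelian groups, i.e. the connecting map $I_f\to H^1(\mathbb P^1_{\mathbb Z},\mathcal O(-3))\cong\mathbb Z^2$ of $0\to\mathcal O(-3)\xrightarrow{f}\mathcal O(n-3)\to\mathcal O_{T_f}(n-3)\to0$. Explicitly, if a section is represented in the charts $x_2\ne0$ and $x_1\neq 0$ by polynomials $p(t)$ and $q(s)$, where $t=x_1/x_2$ and $s=x_2/x_1$, then $p(t)-t^{n-3}q(t^{-1})=f(t,1)\sum_i h_it^i$ with finitely many non-zero $h_i\in\mathbb Z$, and the section maps to $(h_{-1},-h_{-2})$. Write $A\in\mathbb Z^2\otimes\mathbb Z^n\otimes\mathbb Z^n$ as a pair $(A_1,A_2)$ of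 integral $n\times n$ matrices and put $\mathrm{Det}(A)=\det(A_1x_1+A_2x_2)$. Let $G$ be the group of $(g_1,g_2)\in \mathrm{GL}_n(\mathbb Z)\times\mathrm{GL}_n(\mathbb Z)$ with $\det(g_1)\det(g_2)=1$, acting on tensors by $(g_1,g_2)A=(g_1A_1g_2^t,\,g_1A_2g_2^t)$. A *based balanced pair of modules* for $f$ consists of $R_f$-modules $M,N$, $\mathbb Z$-bases $u_1,\dots,u_n$ of $M$ and $w_1,\dots,w_n$ of $N$, and a homomorphism of $R_f$-modules $M\otimes_{R_f}N\to I_f$, such that $\mathrm{Det}(A_1,A_2)=f$, where the $(j,k)$ entry of $A_i$ is the $i$-th coordinate of the image of $u_j\otimes w_k$ under $M\otimes_{R_f}N\to I_f\to V$. Two based balanced pairs are identified if there are $R_f$-module isomorphisms $M\cong M'$ and $N\cong N'$ respecting the bases and the maps to $I_f$. The group $G$ acts on based balanced pairs by changing the bases: $(g_1,g_2)$ replaces $u_j$ by $\sum_k(g_1)_{jk}u_k$ and $w_j$ by $\sum_k(g_2)_{jk}w_k$. A *balanced pair of modules* for $f$ consists of $R_f$-modules $M,N$, each free of rank $n$ over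 $\mathbb Z$, and a homomorphism of $R_f$-modules $M\otimes_{R_f}N\to I_f$, such that for a choice of $\mathbb Z$-bases of $M$ and $N$ the matrices $A_1,A_2$ defined as above satisfy $\mathrm{Det}(A_1,A_2)=\pm f$. An isomorphism of balanced pairs is a pair of $R_f$-module isomorphisms $M\cong M'$, $N\cong N'$ respecting the maps to $I_f$. **Theorem.** The map that sends a based balanced pair to its pair of matrices $(A_1,A_2)$ is a bijection $$\{\text{based balanced pairs }(M,N)\text{ of modules for }f\}\longleftrightarrow\{A\in\mathbb Z^2\otimes\mathbb Z^n\otimes\mathbb Z^n:\ \mathrm{Det}(A)=f\}.$$ It is $G$-equivariant, and it induces (by forgetting bases) a bijection $$\{\text{isomorphism classes of balanced pairs }(M,N)\text{ of modules for }f\}\longleftrightarrow\{G\text{-classes of }A\in\mathbb Z^2\otimes\mathbb Z^n\otimes\mathbb Z^n\text{ with }\mathrm{Det}(A)=f\}.$$ -/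

import Mathlib

open scoped TensorProduct LaurentPolynomial Polynomial

universe u

noncomputable section

namespace BinForm

/-! ### Binary forms and the two affine charts -/

/-- Integral binary `n`-ic forms: homogeneous polynomials of degree `n` over `ℤ` in the two
variables `x₁ = X 0` and `x₂ = X 1`. -/
abbrev Form (n : ℕ) := ↥(MvPolynomial.homogeneousSubmodule (Fin 2) ℤ n)

variable {n : ℕ}

/-- `f(t, 1)`, the equation of `T_f ⊆ ℙ¹` in the chart `x₂ ≠ 0` with coordinate `t = x₁ / x₂`. -/
def eqn₀ (f : Form n) : ℤ[X] :=
  MvPolynomial.aeval ![Polynomial.X, 1] (f : MvPolynomial (Fin 2) ℤ)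

/-- `f(1, s)`, the equation of `T_f ⊆ ℙ¹` in the chart `x₁ ≠ 0` with coordinate `s = x₂ / x₁`. -/
def eqn₁ (f : Form n) : ℤ[X] :=
  MvPolynomial.aeval ![1, Polynomial.X] (f : MvPolynomial (Fin 2) ℤ)

/-- The function `s = t⁻¹` on the overlap of the two charts: `q(s) ↦ q(t⁻¹)`. -/
def fromS : ℤ[X] →+* ℤ[T;T⁻¹] :=
  (LaurentPolynomial.invert (R := ℤ) : ℤ[T;T⁻¹] →+* ℤ[T;T⁻¹]).comp Polynomial.toLaurent

theorem fromS_X : fromS Polynomial.X = LaurentPolynomial.T (-1) := by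
  simp [fromS]

theorem toLaurent_eqn₀ (f : Form n) :
    Polynomial.toLaurent (eqn₀ f) = MvPolynomial.aeval ![LaurentPolynomial.T 1, 1]
      (f : MvPolynomial (Fin 2) ℤ) := by
  rw [eqn₀, ← Polynomial.toLaurentAlg_apply]
  simp only [← AlgHom.comp_apply]
  congr 1
  ext i
  fin_cases i <;> simp

/-- On the overlap, `f(1, t⁻¹) = t⁻ⁿ f(t, 1)`. -/
theorem fromS_eqn₁ (f : Form n) :
    fromS (eqn₁ f) = LaurentPolynomial.T (-(n : ℤ)) * Polynomial.toLaurent (eqn₀ f) := by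
  have hf := (MvPolynomial.mem_homogeneousSubmodule _ _).1 f.2
  rw [eqn₁, eqn₀]
  simp only [MvPolynomial.aeval_def, MvPolynomial.eval₂_eq', map_sum, map_mul, Finset.mul_sum,
    Fin.prod_univ_two]
  refine Finset.sum_congr rfl fun d hd => ?_
  have h1 : d 0 + d 1 = n := by
    have := hf (MvPolynomial.mem_support_iff.1 hd)
    simpa [Finsupp.weight_apply, Finsupp.sum_fintype] using this
  have h2 : (LaurentPolynomial.T (-(n : ℤ)) : ℤ[T;T⁻¹]) * LaurentPolynomial.T (d 0 : ℤ)
      = LaurentPolynomial.T (-(d 1 : ℤ)) := by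
    rw [← LaurentPolynomial.T_add]
    congr 1
    omega
  simp only [map_pow, Matrix.cons_val_zero, Matrix.cons_val_one, fromS_X, map_one, one_pow,
    one_mul, mul_one, Polynomial.toLaurent_X, LaurentPolynomial.T_pow, eq_intCast, map_intCast]
  simp only [mul_neg, mul_one]
  rw [mul_left_comm, h2]

theorem eqn₀_ne_zero {f : Form n} (hf0 : f ≠ 0) : eqn₀ f ≠ 0 := by
  have hf := (MvPolynomial.mem_homogeneousSubmodule _ _).1 f.2
  have hdeg : ∀ d, MvPolynomial.coeff d (f : MvPolynomial (Fin 2) ℤ) ≠ 0 → d 0 + d 1 = n := by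
    intro d hd
    simpa [Finsupp.weight_apply, Finsupp.sum_fintype] using hf hd
  have hne : (f : MvPolynomial (Fin 2) ℤ) ≠ 0 := fun h => hf0 (Subtype.ext h)
  obtain ⟨d, hd⟩ := MvPolynomial.ne_zero_iff.1 hne
  intro h
  apply hd
  have hc : (eqn₀ f).coeff (d 0) = 0 := by simp [h]
  rw [eqn₀, MvPolynomial.aeval_def, MvPolynomial.eval₂_eq', Polynomial.finsetSum_coeff,
    Finset.sum_eq_single d] at hc
  · simp only [Fin.prod_univ_two, Matrix.cons_val_zero, Matrix.cons_val_one, one_pow, mul_one,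
      eq_intCast, Polynomial.coeff_intCast_mul,
      Polynomial.coeff_X_pow_self] at hc
    exact hc
  · intro e he hed
    have h3 : d 0 ≠ e 0 := by
      intro h4
      apply hed
      have h5 := hdeg e (MvPolynomial.mem_support_iff.1 he)
      have h6 := hdeg d hd
      ext i
      fin_cases i
      · exact h4.symm
      · show e 1 = d 1
        omega
    simp only [Fin.prod_univ_two, Matrix.cons_val_zero, Matrix.cons_val_one, one_pow, mul_one,
      eq_intCast, Polynomial.coeff_intCast_mul,
      Polynomial.coeff_X_pow, if_neg h3, mul_zero]
  · intro h7
    exact absurd (MvPolynomial.mem_support_iff.2 hd) h7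

/-! ### The ring `R_f` and the module `I_f`

`T_f` is the closed subscheme of `ℙ¹` over `ℤ` cut out by `f`.  It is covered by the two affine
charts above, so that global sections of `𝒪(k)` on `T_f` are pairs of functions on the two charts
that are glued on the overlap by `x₁ᵏ = tᵏ x₂ᵏ`. -/

/-- Functions on the chart `x₂ ≠ 0` of `T_f`. -/
abbrev Chart₀ (f : Form n) := ℤ[X] ⧸ Ideal.span {eqn₀ f}

/-- Functions on the chart `x₁ ≠ 0` of `T_f`. -/
abbrev Chart₁ (f : Form n) := ℤ[X] ⧸ Ideal.span {eqn₁ f}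

/-- Functions on the overlap `x₁ x₂ ≠ 0` of `T_f`. -/
abbrev Overlap (f : Form n) := ℤ[T;T⁻¹] ⧸ Ideal.span {Polynomial.toLaurent (eqn₀ f)}

/-- Restriction of functions from the chart `x₂ ≠ 0` to the overlap. -/
def res₀ (f : Form n) : Chart₀ f →+* Overlap f :=
  Ideal.quotientMap _ Polynomial.toLaurent <| by
    rw [Ideal.span_singleton_le_iff_mem, Ideal.mem_comap]
    exact Ideal.mem_span_singleton_self _

/-- Restriction of functions from the chart `x₁ ≠ 0` to the overlap. -/
def res₁ (f : Form n) : Chart₁ f →+* Overlap f :=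
  Ideal.quotientMap _ fromS <| by
    rw [Ideal.span_singleton_le_iff_mem, Ideal.mem_comap, fromS_eqn₁]
    exact Ideal.mul_mem_left _ _ (Ideal.mem_span_singleton_self _)

/-- The ring `R_f` of global regular functions on `T_f`. -/
def ringR (f : Form n) : Subring (Chart₀ f × Chart₁ f) :=
  RingHom.eqLocus ((res₀ f).comp (RingHom.fst _ _)) ((res₁ f).comp (RingHom.snd _ _))

/-- The `R_f`-module `I_f` of global sections of `𝒪(n - 3)` on `T_f`. -/
def moduleI (f : Form n) : Submodule (ringR f) (Chart₀ f × Chart₁ f) where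
  carrier := {x | res₀ f x.1 =
    Ideal.Quotient.mk _ (LaurentPolynomial.T ((n : ℤ) - 3)) * res₁ f x.2}
  add_mem' := by
    intro a b ha hb
    simp only [Set.mem_ofPred_eq, Prod.fst_add, Prod.snd_add, map_add, mul_add] at *
    rw [ha, hb]
  zero_mem' := by simp
  smul_mem' := by
    rintro ⟨c, hc⟩ x hx
    have hc' : res₀ f c.1 = res₁ f c.2 := hc
    simp only [Set.mem_ofPred_eq] at *
    rw [Subring.smul_def]
    simp only [Prod.fst_mul, Prod.snd_mul, smul_eq_mul, map_mul]
    rw [hx, hc']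
    ring

/-! ### The canonical map `I_f → V = ℤ²`

It is the connecting map `H⁰(T_f, 𝒪(n-3)) → H¹(ℙ¹, 𝒪(-3)) ≅ ℤ²` of the exact sequence
`0 → 𝒪(-3) → 𝒪(n-3) → 𝒪_{T_f}(n-3) → 0`: lift the two components of a section to polynomials
`p(t)`, `q(s)`, write `p(t) - tⁿ⁻³ q(t⁻¹) = f(t, 1) h(t)` with a Laurent polynomial `h`, and take
the coefficients of `t⁻¹` and (with a sign) of `t⁻²` in `h`.  When `f₀ ≠ 0`, with `θ = t`, these are
the functionals `ζ̌_{n-1}` and `-ζ̌_{n-2}`. -/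

/-- `(p, q, h)` computes the connecting map at the section `x`. -/
def IsLift (f : Form n) (x : Chart₀ f × Chart₁ f) (p q : ℤ[X]) (h : ℤ[T;T⁻¹]) : Prop :=
  Ideal.Quotient.mk _ p = x.1 ∧ Ideal.Quotient.mk _ q = x.2 ∧
    Polynomial.toLaurent p - LaurentPolynomial.T ((n : ℤ) - 3) * fromS q =
      Polynomial.toLaurent (eqn₀ f) * h

theorem exists_isLift (f : Form n) (x : moduleI f) : ∃ p q h, IsLift f x.1 p q h := by
  obtain ⟨⟨a, b⟩, hx⟩ := x
  obtain ⟨p, rfl⟩ := Ideal.Quotient.mk_surjective a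
  obtain ⟨q, rfl⟩ := Ideal.Quotient.mk_surjective b
  have hx' : res₀ f (Ideal.Quotient.mk _ p) =
    Ideal.Quotient.mk _ (LaurentPolynomial.T ((n : ℤ) - 3)) *
      res₁ f (Ideal.Quotient.mk _ q) := hx
  rw [res₀, res₁, Ideal.quotientMap_mk, Ideal.quotientMap_mk, ← map_mul, Ideal.Quotient.eq,
    Ideal.mem_span_singleton] at hx'
  obtain ⟨h, hh⟩ := hx'
  exact ⟨p, q, h, rfl, rfl, hh⟩

/-- The pair of coefficients of `t⁻¹` and (with a sign) of `t⁻²`. -/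
def polar : ℤ[T;T⁻¹] →+ (Fin 2 → ℤ) where
  toFun h := ![h.coeff (-1), -h.coeff (-2)]
  map_zero' := by
    ext i
    fin_cases i <;> simp
  map_add' a b := by
    ext i
    fin_cases i <;> simp [add_comm]

theorem polar_single {m : ℤ} (a : ℤ) (h1 : m ≠ -1) (h2 : m ≠ -2) :
    polar (LaurentPolynomial.C a * LaurentPolynomial.T m) = 0 := by
  have h : ∀ k, k ≠ m → (LaurentPolynomial.C a * LaurentPolynomial.T m).coeff k = 0 := by
    intro k hk
    rw [← LaurentPolynomial.single_eq_C_mul_T, AddMonoidAlgebra.coeff_single,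
      Finsupp.single_eq_of_ne hk]
  ext i
  fin_cases i
  · exact h _ h1.symm
  · exact neg_eq_zero.2 (h _ h2.symm)

theorem polar_toLaurent (p : ℤ[X]) : polar (Polynomial.toLaurent p) = 0 := by
  induction p using Polynomial.induction_on' with
  | add p q hp hq => rw [map_add, map_add, hp, hq, add_zero]
  | monomial m a =>
    rw [← Polynomial.C_mul_X_pow_eq_monomial, Polynomial.toLaurent_C_mul_X_pow]
    exact polar_single a (by omega) (by omega)

theorem polar_fromS (q : ℤ[X]) : polar (LaurentPolynomial.T (-3) * fromS q) = 0 := by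
  induction q using Polynomial.induction_on' with
  | add p q hp hq => rw [map_add, mul_add, map_add, hp, hq, add_zero]
  | monomial m a =>
    have h : (LaurentPolynomial.T (-3) : ℤ[T;T⁻¹]) * fromS (Polynomial.monomial m a) =
        LaurentPolynomial.C a * LaurentPolynomial.T (-3 - (m : ℤ)) := by
      rw [← Polynomial.C_mul_X_pow_eq_monomial, map_mul, map_pow, fromS_X, LaurentPolynomial.T_pow,
        mul_left_comm, ← LaurentPolynomial.T_add]
      simp [fromS, sub_eq_add_neg]
    rw [h]
    exact polar_single a (by omega) (by omega)

/-- The value of the connecting map does not depend on the lift. -/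
theorem IsLift.polar_eq {f : Form n} (hf : f ≠ 0) {x : Chart₀ f × Chart₁ f} {p q p' q' : ℤ[X]}
    {h h' : ℤ[T;T⁻¹]} (H : IsLift f x p q h) (H' : IsLift f x p' q' h') : polar h = polar h' := by
  obtain ⟨h1, h2, h3⟩ := H
  obtain ⟨h1', h2', h3'⟩ := H'
  obtain ⟨a, ha⟩ := Ideal.mem_span_singleton.1 (Ideal.Quotient.eq.1 (h1.trans h1'.symm))
  obtain ⟨b, hb⟩ := Ideal.mem_span_singleton.1 (Ideal.Quotient.eq.1 (h2.trans h2'.symm))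
  have hF : Polynomial.toLaurent (eqn₀ f) ≠ 0 :=
    Polynomial.toLaurent_ne_zero.2 (eqn₀_ne_zero hf)
  have ha' := congrArg Polynomial.toLaurent ha
  have hb' := congrArg fromS hb
  rw [map_sub, map_mul] at ha' hb'
  rw [fromS_eqn₁] at hb'
  have hT : (LaurentPolynomial.T ((n : ℤ) - 3) : ℤ[T;T⁻¹]) * LaurentPolynomial.T (-(n : ℤ)) =
      LaurentPolynomial.T (-3) := by
    rw [← LaurentPolynomial.T_add]
    congr 1
    ring
  have key : h = h' + Polynomial.toLaurent a - LaurentPolynomial.T (-3) * fromS b := by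
    apply mul_left_cancel₀ hF
    rw [← hT]
    linear_combination -h3 + h3' + ha' - LaurentPolynomial.T ((n : ℤ) - 3) * hb'
  rw [key, map_sub, map_add, polar_toLaurent, polar_fromS, add_zero, sub_zero]

theorem IsLift.add {f : Form n} {x x' : Chart₀ f × Chart₁ f} {p q p' q' : ℤ[X]}
    {h h' : ℤ[T;T⁻¹]} (H : IsLift f x p q h) (H' : IsLift f x' p' q' h') :
    IsLift f (x + x') (p + p') (q + q') (h + h') := by
  obtain ⟨h1, h2, h3⟩ := H
  obtain ⟨h1', h2', h3'⟩ := H'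
  refine ⟨by rw [map_add, h1, h1', Prod.fst_add], by rw [map_add, h2, h2', Prod.snd_add], ?_⟩
  rw [map_add, map_add]
  linear_combination h3 + h3'

/-- The polar part `h` of some lift of the section `x`. -/
def polarPart (f : Form n) (x : moduleI f) : ℤ[T;T⁻¹] :=
  (exists_isLift f x).choose_spec.choose_spec.choose

theorem polarPart_isLift (f : Form n) (x : moduleI f) : ∃ p q, IsLift f x.1 p q (polarPart f x) :=
  ⟨_, _, (exists_isLift f x).choose_spec.choose_spec.choose_spec⟩

/-- The canonical map `I_f → V = ℤ²` of abelian groups. -/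
def toV {f : Form n} (hf : f ≠ 0) : moduleI f →+ (Fin 2 → ℤ) :=
  AddMonoidHom.mk' (fun x => polar (polarPart f x)) <| by
    intro x y
    obtain ⟨p, q, H⟩ := polarPart_isLift f x
    obtain ⟨p', q', H'⟩ := polarPart_isLift f y
    obtain ⟨p'', q'', H''⟩ := polarPart_isLift f (x + y)
    rw [H''.polar_eq hf (H.add H'), map_add]

/-- The canonical map can be computed from any lift. -/
theorem toV_eq {f : Form n} (hf : f ≠ 0) (x : moduleI f) {p q : ℤ[X]} {h : ℤ[T;T⁻¹]}
    (H : IsLift f x.1 p q h) : toV hf x = polar h := by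
  obtain ⟨p', q', H'⟩ := polarPart_isLift f x
  exact H'.polar_eq hf H

/-! ### Tensors -/

/-- Elements `A` of `ℤ² ⊗ ℤⁿ ⊗ ℤⁿ`, written as pairs `(A₁, A₂) = (A 0, A 1)` of matrices. -/
abbrev Tensor (n : ℕ) := Fin 2 → Matrix (Fin n) (Fin n) ℤ

/-- `Det(A) = det(A₁ x₁ + A₂ x₂)`. -/
def Det (A : Tensor n) : MvPolynomial (Fin 2) ℤ :=
  Matrix.det ((MvPolynomial.X 0 : MvPolynomial (Fin 2) ℤ) • (A 0).map MvPolynomial.C +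
    (MvPolynomial.X 1 : MvPolynomial (Fin 2) ℤ) • (A 1).map MvPolynomial.C :
    Matrix (Fin n) (Fin n) (MvPolynomial (Fin 2) ℤ))

/-- The group `G` of pairs `(g₁, g₂)` in `GLₙ(ℤ) × GLₙ(ℤ)` with `det g₁ * det g₂ = 1`. -/
def G (n : ℕ) : Subgroup (GL (Fin n) ℤ × GL (Fin n) ℤ) where
  carrier := {g | Matrix.GeneralLinearGroup.det g.1 * Matrix.GeneralLinearGroup.det g.2 = 1}
  mul_mem' := by
    intro a b ha hb
    simp only [Set.mem_ofPred_eq, Prod.fst_mul, Prod.snd_mul, map_mul] at *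
    rw [mul_mul_mul_comm, ha, hb, one_mul]
  one_mem' := by simp
  inv_mem' := by
    intro a ha
    simp only [Set.mem_ofPred_eq, Prod.fst_inv, Prod.snd_inv, map_inv] at *
    rw [← mul_inv, ha, inv_one]

/-- `(g₁, g₂) A = (g₁ A₁ g₂ᵗ, g₁ A₂ g₂ᵗ)`. -/
def act (g : GL (Fin n) ℤ × GL (Fin n) ℤ) (A : Tensor n) : Tensor n :=
  fun i => g.1.val * A i * g.2.val.transpose

theorem Det_act (g : G n) (A : Tensor n) : Det (act g.1 A) = Det A := by
  obtain ⟨⟨g, h⟩, hg⟩ := g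
  have hg' : g.val.det * h.val.det = 1 := congrArg Units.val hg
  have key : (MvPolynomial.X 0 : MvPolynomial (Fin 2) ℤ) •
        (MvPolynomial.C.mapMatrix (g.val * A 0 * h.val.transpose) :
          Matrix (Fin n) (Fin n) (MvPolynomial (Fin 2) ℤ)) +
      (MvPolynomial.X 1 : MvPolynomial (Fin 2) ℤ) •
        MvPolynomial.C.mapMatrix (g.val * A 1 * h.val.transpose) =
      MvPolynomial.C.mapMatrix g.val *
        ((MvPolynomial.X 0 : MvPolynomial (Fin 2) ℤ) • MvPolynomial.C.mapMatrix (A 0) +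
          (MvPolynomial.X 1 : MvPolynomial (Fin 2) ℤ) • MvPolynomial.C.mapMatrix (A 1)) *
        MvPolynomial.C.mapMatrix h.val.transpose := by
    simp only [map_mul, Matrix.mul_add, Matrix.add_mul, Matrix.mul_smul, Matrix.smul_mul]
  have hd : ∀ B : Tensor n, Det B = Matrix.det
      ((MvPolynomial.X 0 : MvPolynomial (Fin 2) ℤ) • MvPolynomial.C.mapMatrix (B 0) +
        (MvPolynomial.X 1 : MvPolynomial (Fin 2) ℤ) • MvPolynomial.C.mapMatrix (B 1)) :=
    fun _ => rfl
  rw [hd, hd]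
  simp only [act]
  rw [key, Matrix.det_mul, Matrix.det_mul, ← RingHom.map_det, ← RingHom.map_det,
    Matrix.det_transpose, mul_right_comm, ← map_mul, hg', map_one, one_mul]

/-- The set of tensors `A` with `Det(A) = f`. -/
def TensorOfDet (f : Form n) := {A : Tensor n // Det A = f}

instance (f : Form n) : MulAction (G n) (TensorOfDet f) where
  smul g A := ⟨act g.1 A.1, (Det_act g A.1).trans A.2⟩
  one_smul A := Subtype.ext <| funext fun i => by
    change (1 : Matrix (Fin n) (Fin n) ℤ) * A.1 i * (1 : Matrix (Fin n) (Fin n) ℤ).transpose = _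
    simp
  mul_smul g h A := Subtype.ext <| funext fun i => by
    change (g.1.1.val * h.1.1.val) * A.1 i * (g.1.2.val * h.1.2.val).transpose =
      g.1.1.val * (h.1.1.val * A.1 i * h.1.2.val.transpose) * g.1.2.val.transpose
    simp only [Matrix.transpose_mul, Matrix.mul_assoc]

/-! ### Balanced pairs -/

/-- The pair of matrices of `M ⊗_ℤ N → M ⊗_{R_f} N → I_f → V` in given bases of `M` and `N`: the
`(j, k)` entry of the `i`-th matrix is the `i`-th coordinate of the image of `m_j ⊗ n_k`. -/
def matrices {f : Form n} (hf : f ≠ 0) {M N : Type u} [AddCommGroup M] [AddCommGroup N]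
    [Module (ringR f) M] [Module (ringR f) N] (φ : M ⊗[ringR f] N →ₗ[ringR f] moduleI f)
    (b : Module.Basis (Fin n) ℤ M) (c : Module.Basis (Fin n) ℤ N) : Tensor n :=
  fun i => Matrix.of fun j k => toV hf (φ (b j ⊗ₜ[ringR f] c k)) i

/-- Based balanced pairs of modules for `f`. -/
structure BasedBalancedPair (f : Form n) (hf : f ≠ 0) where
  M : Type u
  N : Type u
  [addCommGroupM : AddCommGroup M]
  [addCommGroupN : AddCommGroup N]
  [moduleM : Module (ringR f) M]
  [moduleN : Module (ringR f) N]
  basisM : Module.Basis (Fin n) ℤ M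
  basisN : Module.Basis (Fin n) ℤ N
  pairing : M ⊗[ringR f] N →ₗ[ringR f] moduleI f
  det_eq : Det (matrices hf pairing basisM basisN) = f

/-- Balanced pairs of modules for `f`.  The existence of the two bases says in particular that
`M` and `N` are free of rank `n` over `ℤ`; up to sign, the determinant does not depend on them. -/
structure BalancedPair (f : Form n) (hf : f ≠ 0) where
  M : Type u
  N : Type u
  [addCommGroupM : AddCommGroup M]
  [addCommGroupN : AddCommGroup N]
  [moduleM : Module (ringR f) M]
  [moduleN : Module (ringR f) N]
  pairing : M ⊗[ringR f] N →ₗ[ringR f] moduleI f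
  det_eq : ∃ (b : Module.Basis (Fin n) ℤ M) (c : Module.Basis (Fin n) ℤ N),
    Det (matrices hf pairing b c) = f ∨ Det (matrices hf pairing b c) = -f

attribute [instance] BasedBalancedPair.addCommGroupM BasedBalancedPair.addCommGroupN
  BasedBalancedPair.moduleM BasedBalancedPair.moduleN
  BalancedPair.addCommGroupM BalancedPair.addCommGroupN BalancedPair.moduleM BalancedPair.moduleN

variable {f : Form n} {hf : f ≠ 0}

/-- Two balanced pairs are isomorphic if there are isomorphisms of `R_f`-modules `M ≅ M'` and
`N ≅ N'` that respect the balancing maps. -/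
instance BalancedPair.setoid : Setoid (BalancedPair.{u} f hf) where
  r P Q := ∃ (α : P.M ≃ₗ[ringR f] Q.M) (β : P.N ≃ₗ[ringR f] Q.N),
    ∀ x y, Q.pairing (α x ⊗ₜ β y) = P.pairing (x ⊗ₜ y)
  iseqv := {
    refl := fun P => ⟨.refl _ _, .refl _ _, fun _ _ => rfl⟩
    symm := by
      rintro P Q ⟨α, β, h⟩
      exact ⟨α.symm, β.symm, fun x y => by simp [← h]⟩
    trans := by
      rintro P Q S ⟨α, β, h⟩ ⟨α', β', h'⟩
      exact ⟨α.trans α', β.trans β', fun x y => by simp [h, h']⟩ }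

/-- Two based balanced pairs are isomorphic (and are considered to be the same) if there are
isomorphisms of `R_f`-modules `M ≅ M'` and `N ≅ N'` that respect the bases and the balancing
maps. -/
instance BasedBalancedPair.setoid : Setoid (BasedBalancedPair.{u} f hf) where
  r P Q := ∃ (α : P.M ≃ₗ[ringR f] Q.M) (β : P.N ≃ₗ[ringR f] Q.N),
    (∀ i, α (P.basisM i) = Q.basisM i) ∧ (∀ i, β (P.basisN i) = Q.basisN i) ∧
    ∀ x y, Q.pairing (α x ⊗ₜ β y) = P.pairing (x ⊗ₜ y)
  iseqv := {
    refl := fun P => ⟨.refl _ _, .refl _ _, fun _ => rfl, fun _ => rfl, fun _ _ => rfl⟩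
    symm := by
      rintro P Q ⟨α, β, h1, h2, h⟩
      exact ⟨α.symm, β.symm, fun i => by simp [← h1], fun i => by simp [← h2],
        fun x y => by simp [← h]⟩
    trans := by
      rintro P Q S ⟨α, β, h1, h2, h⟩ ⟨α', β', h1', h2', h'⟩
      exact ⟨α.trans α', β.trans β', fun i => by simp [h1, h1'], fun i => by simp [h2, h2'],
        fun x y => by simp [h, h']⟩ }

/-- Forget the bases. -/
def BasedBalancedPair.toBalancedPair (P : BasedBalancedPair.{u} f hf) : BalancedPair.{u} f hf where
  M := P.M
  N := P.N
  pairing := P.pairing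
  det_eq := ⟨P.basisM, P.basisN, Or.inl P.det_eq⟩

/-- The tensor of a based balanced pair: the matrices of its balancing map, composed with
`I_f → V`, in the given bases. -/
def BasedBalancedPair.tensor (P : BasedBalancedPair.{u} f hf) : TensorOfDet f :=
  ⟨matrices hf P.pairing P.basisM P.basisN, P.det_eq⟩

/-! ### The action of `G` on the bases -/

/-- The basis `m'_j = ∑ₖ g_{jk} m_k`. -/
def changeBasis {M : Type u} [AddCommGroup M] (g : GL (Fin n) ℤ) (b : Module.Basis (Fin n) ℤ M) :
    Module.Basis (Fin n) ℤ M :=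
  Module.Basis.ofEquivFun <| b.equivFun.trans
    { toFun := fun c => Matrix.vecMul c g⁻¹.val
      invFun := fun c => Matrix.vecMul c g.val
      map_add' := fun c d => Matrix.add_vecMul _ _ _
      map_smul' := fun r c => Matrix.smul_vecMul _ _ _
      left_inv := fun c => by
        beta_reduce
        rw [Matrix.vecMul_vecMul, ← Units.val_mul, inv_mul_cancel, Units.val_one, Matrix.vecMul_one]
      right_inv := fun c => by
        beta_reduce
        rw [Matrix.vecMul_vecMul, ← Units.val_mul, mul_inv_cancel, Units.val_one,
          Matrix.vecMul_one] }

theorem changeBasis_apply {M : Type u} [AddCommGroup M] (g : GL (Fin n) ℤ)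
    (b : Module.Basis (Fin n) ℤ M) (j : Fin n) :
    changeBasis g b j = ∑ k, g.val j k • b k := by
  simp [changeBasis, Module.Basis.equivFun_symm_apply]

theorem changeBasis_one {M : Type u} [AddCommGroup M] (b : Module.Basis (Fin n) ℤ M) :
    changeBasis 1 b = b := by
  ext j
  simp [changeBasis_apply, Matrix.one_apply]

theorem changeBasis_mul {M : Type u} [AddCommGroup M] (g h : GL (Fin n) ℤ)
    (b : Module.Basis (Fin n) ℤ M) :
    changeBasis (g * h) b = changeBasis g (changeBasis h b) := by
  ext j
  simp only [changeBasis_apply, Units.val_mul, Matrix.mul_apply, Finset.sum_smul, Finset.smul_sum,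
    mul_smul]
  exact Finset.sum_comm

theorem matrices_changeBasis {M N : Type u} [AddCommGroup M] [AddCommGroup N]
    [Module (ringR f) M] [Module (ringR f) N] (φ : M ⊗[ringR f] N →ₗ[ringR f] moduleI f)
    (b : Module.Basis (Fin n) ℤ M) (c : Module.Basis (Fin n) ℤ N)
    (g : GL (Fin n) ℤ × GL (Fin n) ℤ) :
    matrices hf φ (changeBasis g.1 b) (changeBasis g.2 c) = act g (matrices hf φ b c) := by
  ext i j k
  let ψ : M →+ N →+ ℤ := AddMonoidHom.mk' (fun x => AddMonoidHom.mk'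
      (fun y => toV hf (φ (x ⊗ₜ y)) i) fun y y' => by simp [TensorProduct.tmul_add])
    fun x x' => by ext y; simp [TensorProduct.add_tmul]
  have hψ : ∀ (b : Module.Basis (Fin n) ℤ M) (c : Module.Basis (Fin n) ℤ N) j k,
      matrices hf φ b c i j k = ψ (b j) (c k) := fun _ _ _ _ => rfl
  rw [hψ, changeBasis_apply, changeBasis_apply]
  simp only [act, Matrix.mul_apply, hψ, map_sum, map_zsmul, AddMonoidHom.finsetSum_apply,
    AddMonoidHom.zsmul_apply, Matrix.transpose_apply, Finset.sum_mul,
    smul_eq_mul]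
  refine Finset.sum_congr rfl fun l _ => ?_
  rw [Finset.mul_sum]
  refine Finset.sum_congr rfl fun m _ => ?_
  ring

theorem BasedBalancedPair.mk_congr {M N : Type u} [AddCommGroup M] [AddCommGroup N]
    [Module (ringR f) M] [Module (ringR f) N] {φ : M ⊗[ringR f] N →ₗ[ringR f] moduleI f}
    {b b' : Module.Basis (Fin n) ℤ M} {c c' : Module.Basis (Fin n) ℤ N}
    (h : Det (matrices hf φ b c) = f) (h' : Det (matrices hf φ b' c') = f)
    (hb : b = b') (hc : c = c') :
    BasedBalancedPair.mk (hf := hf) M N b c φ h = BasedBalancedPair.mk M N b' c' φ h' := by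
  subst hb hc
  rfl

/-- `G` acts on based balanced pairs by changing the bases of `M` and `N`. -/
instance : MulAction (G n) (BasedBalancedPair.{u} f hf) where
  smul g P :=
    { M := P.M
      N := P.N
      basisM := changeBasis g.1.1 P.basisM
      basisN := changeBasis g.1.2 P.basisN
      pairing := P.pairing
      det_eq := by rw [matrices_changeBasis, Det_act, P.det_eq] }
  one_smul P := BasedBalancedPair.mk_congr _ _ (changeBasis_one _) (changeBasis_one _)
  mul_smul g h P :=
    BasedBalancedPair.mk_congr _ _ (changeBasis_mul _ _ _) (changeBasis_mul _ _ _)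
/-! ### Sets of classes -/

/-- Based balanced pairs for `f`, up to isomorphism preserving the bases. -/
abbrev BasedBalancedPairs (f : Form n) (hf : f ≠ 0) :=
  Quotient (BasedBalancedPair.setoid.{u} (f := f) (hf := hf))

/-- Isomorphism classes of balanced pairs for `f`. -/
abbrev BalancedPairClasses (f : Form n) (hf : f ≠ 0) :=
  Quotient (BalancedPair.setoid.{u} (f := f) (hf := hf))

/-- `G`-classes of tensors `A` with `Det(A) = f`. -/
abbrev TensorClasses (f : Form n) := MulAction.orbitRel.Quotient (G n) (TensorOfDet f)

/-- The `G`-class of a tensor. -/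
def TensorOfDet.toClass (A : TensorOfDet f) : TensorClasses f :=
  Quotient.mk (MulAction.orbitRel (G n) (TensorOfDet f)) A

end BinForm

end

noncomputable section

namespace BinForm

variable {n : ℕ}

/-! ### Coefficients of Laurent polynomials -/

/-! A tensor `A` with `Det A = f` is a pencil `L = t A₁ + A₂` (`A₁ = A 0`, `A₂ = A 1`) with
determinant `f(t, 1)`. Its cokernel `E` on `ℙ¹` is killed by `f`, so it lives on `T_f`. The sequence
`0 → 𝒪(-2)ⁿ → 𝒪(-1)ⁿ → E(-1) → 0` identifies `H⁰(E(-1))` with `H¹(𝒪(-2)ⁿ) = ℤⁿ`, and this gives an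
`R_f`-action on `ℤⁿ`. Here it is made explicit with Čech cocycles: existence is `exists_actsBy`,
uniqueness `ActsBy.unique`. This module is `N`; the transposed pencil gives `M`.

The pairing is `xᵗ A₁ adj(L) A₁ y` in the chart `x₂ ≠ 0` and `xᵗ A₂ adj(L₁) A₂ y`, with `L₁ = A₁ + s
A₂`, in the other. By `gram_glue` the two differ, after the twist by `tⁿ⁻³`, by `f(t, 1) (t⁻¹ A₁ -
t⁻² A₂)`. This one identity shows that they glue to a section of `𝒪(n-3)` and that the resulting
tensor in `V` is `A` again.

Conversely, a based pair is determined by its tensor. A section of `𝒪(n-3)` can be read off from the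
values in `V` of its multiples by certain functions `r_m` on `T_f` (`exists_lift_of_testFunction`).
Let `P` be the matrix of lifts of the sections `φ(u_j ⊗ w_k)` and let `S = ∑ tᵐ ρ(r_m)`, where
`ρ(r)` is the matrix of `r` on `N`. Then `A₁ S = P` and `A₂ S = f A₁ - t P`, so `L S = f A₁`, `S =
adj(L) A₁` and `P = A₁ adj(L) A₁` (`pairing_basis_eq_gram`). The `R_f`-actions are forced as well,
because `A` can be cancelled (`exists_linearEquiv_right`, `exists_linearEquiv_left`).

For classes, forgetting bases leaves a choice of `(g₁, g₂)`, and `f ≠ 0` forces `det g₁ * det g₂ =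
1`. A pair with determinant `-f` is corrected by a base change of determinant `-1`. -/

theorem coeff_T_mul (m k : ℤ) (h : ℤ[T;T⁻¹]) :
    (LaurentPolynomial.T m * h).coeff k = h.coeff (k - m) := by
  rw [LaurentPolynomial.T, AddMonoidAlgebra.coeff_single_mul_apply, one_mul, neg_add_eq_sub]

theorem coeff_C_mul (a : ℤ) (h : ℤ[T;T⁻¹]) (k : ℤ) :
    (LaurentPolynomial.C a * h).coeff k = a * h.coeff k := by
  change (AddMonoidAlgebra.single 0 a * h).coeff k = _
  rw [AddMonoidAlgebra.coeff_single_mul_apply, neg_zero, zero_add]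

theorem coeff_T (m k : ℤ) :
    (LaurentPolynomial.T m : ℤ[T;T⁻¹]).coeff k = if k = m then 1 else 0 := by
  rw [LaurentPolynomial.T, AddMonoidAlgebra.coeff_single, Finsupp.single_apply]
  simp [eq_comm]

theorem coeff_C (a k : ℤ) : (LaurentPolynomial.C a).coeff k = if k = 0 then a else 0 := by
  have := coeff_C_mul a (LaurentPolynomial.T 0) k
  rw [LaurentPolynomial.T_zero, mul_one] at this
  rw [this, ← LaurentPolynomial.T_zero, coeff_T, mul_ite, mul_one, mul_zero]

theorem coeff_toLaurent (p : ℤ[X]) (k : ℕ) : (Polynomial.toLaurent p).coeff (k : ℤ) = p.coeff k := by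
  induction p using Polynomial.induction_on' with
  | add p q hp hq => rw [map_add, AddMonoidAlgebra.coeff_add, Finsupp.add_apply, hp, hq,
      Polynomial.coeff_add]
  | monomial m a =>
    rw [← Polynomial.C_mul_X_pow_eq_monomial, Polynomial.toLaurent_C_mul_X_pow, coeff_C_mul,
      coeff_T, Polynomial.coeff_C_mul, Polynomial.coeff_X_pow]
    simp

theorem coeff_toLaurent_of_neg (p : ℤ[X]) {k : ℤ} (hk : k < 0) :
    (Polynomial.toLaurent p).coeff k = 0 := by
  induction p using Polynomial.induction_on' with
  | add p q hp hq => rw [map_add, AddMonoidAlgebra.coeff_add, Finsupp.add_apply, hp, hq, add_zero]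
  | monomial m a =>
    rw [← Polynomial.C_mul_X_pow_eq_monomial, Polynomial.toLaurent_C_mul_X_pow, coeff_C_mul,
      coeff_T, if_neg (by omega), mul_zero]

theorem coeff_fromS (q : ℤ[X]) (k : ℤ) :
    (fromS q).coeff k = (Polynomial.toLaurent q).coeff (-k) := by
  simp [fromS, LaurentPolynomial.invert_apply]

theorem coeff_fromS_of_pos (q : ℤ[X]) {k : ℤ} (hk : 0 < k) : (fromS q).coeff k = 0 := by
  rw [coeff_fromS, coeff_toLaurent_of_neg _ (by omega)]

theorem fromS_C (a : ℤ) : fromS (Polynomial.C a) = LaurentPolynomial.C a := by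
  simp [fromS]

theorem fromS_injective : Function.Injective fromS := by
  intro p q h
  simpa [fromS] using h

/-- A polynomial in `t` that is a polynomial in `t⁻¹` without constant term vanishes. -/
theorem eq_zero_of_toLaurent_eq {p q : ℤ[X]}
    (h : Polynomial.toLaurent p = LaurentPolynomial.T (-1) * fromS q) : p = 0 ∧ q = 0 := by
  have hp : p = 0 := by
    ext k
    rw [← coeff_toLaurent, h, coeff_T_mul, coeff_fromS_of_pos _ (by omega), Polynomial.coeff_zero]
  refine ⟨hp, fromS_injective ?_⟩
  rw [hp, map_zero] at h
  have := congrArg (LaurentPolynomial.T 1 * ·) h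
  simpa [← mul_assoc, ← LaurentPolynomial.T_add] using this.symm

/-- Every Laurent polynomial is the sum of a polynomial in `t` and a polynomial in `t⁻¹` without
constant term. -/
theorem exists_split (h : ℤ[T;T⁻¹]) : ∃ p q : ℤ[X],
    h = Polynomial.toLaurent p + LaurentPolynomial.T (-1) * fromS q := by
  induction h using LaurentPolynomial.induction_on' with
  | add h h' H H' =>
    obtain ⟨p, q, rfl⟩ := H
    obtain ⟨p', q', rfl⟩ := H'
    exact ⟨p + p', q + q', by simp only [map_add]; ring⟩
  | C_mul_T m a =>
    obtain ⟨k, rfl | rfl⟩ : ∃ k : ℕ, m = k ∨ m = -1 - k := by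
      rcases le_or_gt 0 m with h | h
      · exact ⟨m.toNat, Or.inl (by omega)⟩
      · exact ⟨(-1 - m).toNat, Or.inr (by omega)⟩
    · exact ⟨Polynomial.C a * Polynomial.X ^ k, 0, by
        rw [Polynomial.toLaurent_C_mul_X_pow, map_zero, mul_zero, add_zero]⟩
    · refine ⟨0, Polynomial.C a * Polynomial.X ^ k, ?_⟩
      rw [map_zero, zero_add, map_mul, map_pow, fromS_X, fromS_C, LaurentPolynomial.T_pow,
        mul_left_comm, ← LaurentPolynomial.T_add]
      congr 2
      ring

/-- Every Laurent polynomial is the sum of a polynomial in `t`, a multiple of `t⁻¹` and a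
polynomial in `t⁻¹` multiplied by `t⁻²`. -/
theorem exists_split_residue (h : ℤ[T;T⁻¹]) : ∃ (p : ℤ[X]) (a : ℤ) (q : ℤ[X]),
    h = Polynomial.toLaurent p + LaurentPolynomial.T (-1) * LaurentPolynomial.C a +
      LaurentPolynomial.T (-2) * fromS q := by
  obtain ⟨p, q, rfl⟩ := exists_split h
  refine ⟨p, q.coeff 0, q.divX, ?_⟩
  nth_rw 1 [← Polynomial.divX_mul_X_add q]
  rw [map_add, map_mul, fromS_X, fromS_C]
  have : (LaurentPolynomial.T (-2) : ℤ[T;T⁻¹]) =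
      LaurentPolynomial.T (-1) * LaurentPolynomial.T (-1) := by
    rw [← LaurentPolynomial.T_add]; rfl
  rw [this]
  ring

/-- Every Laurent polynomial is the sum of its polar part at `t⁻¹, t⁻²`, a polynomial in `t` and a
polynomial in `t⁻¹` multiplied by `t⁻³`. -/
theorem exists_split_polar (h : ℤ[T;T⁻¹]) : ∃ p q : ℤ[X],
    h = Polynomial.toLaurent p + (LaurentPolynomial.C (polar h 0) * LaurentPolynomial.T (-1) -
      LaurentPolynomial.C (polar h 1) * LaurentPolynomial.T (-2)) +
      LaurentPolynomial.T (-3) * fromS q := by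
  obtain ⟨p, a, q, e⟩ := exists_split_residue h
  have e' : h = Polynomial.toLaurent p + (LaurentPolynomial.C a * LaurentPolynomial.T (-1) +
      LaurentPolynomial.C (q.coeff 0) * LaurentPolynomial.T (-2)) +
      LaurentPolynomial.T (-3) * fromS q.divX := by
    rw [e]
    nth_rw 1 [← Polynomial.divX_mul_X_add q]
    rw [map_add, map_mul, fromS_X, fromS_C]
    have : (LaurentPolynomial.T (-3) : ℤ[T;T⁻¹]) =
        LaurentPolynomial.T (-2) * LaurentPolynomial.T (-1) := by
      rw [← LaurentPolynomial.T_add]; rfl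
    rw [this]
    ring
  have hp : polar h = ![a, -q.coeff 0] := by
    rw [e', map_add, map_add, polar_toLaurent, polar_fromS, zero_add, add_zero]
    ext i
    have hm (m : ℤ) : (LaurentPolynomial.C a * LaurentPolynomial.T (-1) +
        LaurentPolynomial.C (q.coeff 0) * LaurentPolynomial.T (-2) : ℤ[T;T⁻¹]).coeff m =
        a * (if m = -1 then 1 else 0) + q.coeff 0 * (if m = -2 then 1 else 0) := by
      rw [AddMonoidAlgebra.coeff_add, Finsupp.add_apply, coeff_C_mul, coeff_C_mul, coeff_T, coeff_T]
    fin_cases i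
    · exact (hm (-1)).trans (show _ = a by simp)
    · exact (congrArg Neg.neg (hm (-2))).trans (show _ = -q.coeff 0 by simp)
  refine ⟨p, q.divX, ?_⟩
  have h0 : polar h 0 = a := congrFun hp 0
  have h1 : polar h 1 = -q.coeff 0 := congrFun hp 1
  rw [h0, h1, map_neg, neg_mul, sub_neg_eq_add]
  exact e'

/-! ### The pencil of a tensor -/

/-- Constant matrices. -/
abbrev constMatrix : Matrix (Fin n) (Fin n) ℤ →+* Matrix (Fin n) (Fin n) ℤ[X] :=
  Polynomial.C.mapMatrix

/-- The pencil `A₁ t + A₂` in the chart `x₂ ≠ 0`. -/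
def pencil₀ (A : Tensor n) : Matrix (Fin n) (Fin n) ℤ[X] :=
  (Polynomial.X : ℤ[X]) • constMatrix (A 0) + constMatrix (A 1)

/-- The pencil `A₁ + A₂ s` in the chart `x₁ ≠ 0`. -/
def pencil₁ (A : Tensor n) : Matrix (Fin n) (Fin n) ℤ[X] :=
  constMatrix (A 0) + (Polynomial.X : ℤ[X]) • constMatrix (A 1)

theorem aeval_Det (A : Tensor n) (x y : ℤ[X]) : MvPolynomial.aeval ![x, y] (Det A) =
    Matrix.det (x • constMatrix (A 0) + y • constMatrix (A 1)) := by
  rw [Det, AlgHom.map_det]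
  congr 1
  ext1 i j
  simp

theorem det_pencil₀ {f : Form n} {A : Tensor n} (hA : Det A = f) :
    (pencil₀ A).det = eqn₀ f := by
  rw [eqn₀, ← hA, aeval_Det, one_smul, pencil₀]

theorem det_pencil₁ {f : Form n} {A : Tensor n} (hA : Det A = f) :
    (pencil₁ A).det = eqn₁ f := by
  rw [eqn₁, ← hA, aeval_Det, one_smul, pencil₁]

theorem pencil₀_mul_adjugate {f : Form n} {A : Tensor n} (hA : Det A = f) :
    pencil₀ A * (pencil₀ A).adjugate = eqn₀ f • 1 := by
  rw [Matrix.mul_adjugate, det_pencil₀ hA]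

theorem pencil₁_mul_adjugate {f : Form n} {A : Tensor n} (hA : Det A = f) :
    pencil₁ A * (pencil₁ A).adjugate = eqn₁ f • 1 := by
  rw [Matrix.mul_adjugate, det_pencil₁ hA]

theorem mapMatrix_constMatrix₀ (M : Matrix (Fin n) (Fin n) ℤ) :
    Polynomial.toLaurent.mapMatrix (constMatrix M) = LaurentPolynomial.C.mapMatrix M := by
  ext1 i j
  simp

theorem mapMatrix_constMatrix₁ (M : Matrix (Fin n) (Fin n) ℤ) :
    fromS.mapMatrix (constMatrix M) = LaurentPolynomial.C.mapMatrix M := by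
  ext1 i j
  simp

theorem map_pencil₀ (A : Tensor n) : Polynomial.toLaurent.mapMatrix (pencil₀ A) =
    (LaurentPolynomial.T 1 : ℤ[T;T⁻¹]) • LaurentPolynomial.C.mapMatrix (A 0) +
      LaurentPolynomial.C.mapMatrix (A 1) := by
  ext1 i j
  simp [pencil₀]

theorem map_pencil₁ (A : Tensor n) : fromS.mapMatrix (pencil₁ A) =
    (LaurentPolynomial.T (-1) : ℤ[T;T⁻¹]) • Polynomial.toLaurent.mapMatrix (pencil₀ A) := by
  rw [map_pencil₀, smul_add, smul_smul, ← LaurentPolynomial.T_add]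
  ext1 i j
  simp [pencil₁, fromS_X]

/-- The determinant of the pencil is `f(t, 1) ≠ 0` in the domain `ℤ[t, t⁻¹]`, so multiplying by the
adjugate reduces to cancelling a scalar. -/
theorem map_pencil₀_mul_cancel {f : Form n} (hf : f ≠ 0) {A : Tensor n} (hA : Det A = f)
    {Z W : Matrix (Fin n) (Fin n) ℤ[T;T⁻¹]}
    (h : Polynomial.toLaurent.mapMatrix (pencil₀ A) * Z =
      Polynomial.toLaurent.mapMatrix (pencil₀ A) * W) : Z = W := by
  have hd : (Polynomial.toLaurent.mapMatrix (pencil₀ A)).det ≠ 0 := by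
    rw [← RingHom.map_det, det_pencil₀ hA]
    exact Polynomial.toLaurent_ne_zero.2 (eqn₀_ne_zero hf)
  have h' := congrArg ((Polynomial.toLaurent.mapMatrix (pencil₀ A)).adjugate * ·) h
  simp only [← mul_assoc, Matrix.adjugate_mul, Matrix.smul_mul, one_mul] at h'
  exact smul_right_injective _ hd h'

/-- A tensor with non-zero determinant is left cancellable. -/
theorem eq_of_tensor_mul_eq {f : Form n} (hf : f ≠ 0) {A : Tensor n} (hA : Det A = f)
    {ρ σ : Matrix (Fin n) (Fin n) ℤ} (h : ∀ i, A i * ρ = A i * σ) : ρ = σ := by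
  have key : LaurentPolynomial.C.mapMatrix ρ = LaurentPolynomial.C.mapMatrix σ := by
    apply map_pencil₀_mul_cancel hf hA
    rw [map_pencil₀, add_mul, add_mul, Matrix.smul_mul, Matrix.smul_mul, ← map_mul, ← map_mul,
      ← map_mul, ← map_mul, h, h]
  ext i j
  have hij : (LaurentPolynomial.C (ρ i j)).coeff 0 = (LaurentPolynomial.C (σ i j)).coeff 0 :=
    congrArg (fun M => (M i j).coeff 0) key
  rwa [coeff_C, coeff_C] at hij

/-! ### The action of `R_f` on the module of a tensor -/

/-- The function `r` acts on `ℤⁿ = H⁰(E(-1))`, where `E` is the cokernel of the pencil of `A`,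
through the matrix `ρ`: multiplication by `r` agrees with `ρ` in both charts. -/
def ActsBy {f : Form n} (A : Tensor n) (r : Chart₀ f × Chart₁ f)
    (ρ : Matrix (Fin n) (Fin n) ℤ) : Prop :=
  ∃ (a b : ℤ[X]) (X Y : Matrix (Fin n) (Fin n) ℤ[X]),
    Ideal.Quotient.mk _ a = r.1 ∧ Ideal.Quotient.mk _ b = r.2 ∧
    a • constMatrix (A 0) = constMatrix (A 0 * ρ) + pencil₀ A * X ∧
    b • constMatrix (A 1) = constMatrix (A 1 * ρ) + pencil₁ A * Y

namespace ActsBy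

variable {f : Form n} {A : Tensor n} {r r' : Chart₀ f × Chart₁ f}
  {ρ ρ' : Matrix (Fin n) (Fin n) ℤ}

theorem one : ActsBy A (1 : Chart₀ f × Chart₁ f) 1 :=
  ⟨1, 1, 0, 0, by simp, by simp, by simp, by simp⟩

theorem add (H : ActsBy A r ρ) (H' : ActsBy A r' ρ') : ActsBy A (r + r') (ρ + ρ') := by
  obtain ⟨a, b, X, Y, h1, h2, h3, h4⟩ := H
  obtain ⟨a', b', X', Y', h1', h2', h3', h4'⟩ := H'
  refine ⟨a + a', b + b', X + X', Y + Y', by rw [map_add, h1, h1', Prod.fst_add],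
    by rw [map_add, h2, h2', Prod.snd_add], ?_, ?_⟩
  · rw [add_smul, h3, h3', mul_add, mul_add, map_add]
    abel
  · rw [add_smul, h4, h4', mul_add, mul_add, map_add]
    abel

theorem neg (H : ActsBy A r ρ) : ActsBy A (-r) (-ρ) := by
  obtain ⟨a, b, X, Y, h1, h2, h3, h4⟩ := H
  refine ⟨-a, -b, -X, -Y, by rw [map_neg, h1, Prod.fst_neg], by rw [map_neg, h2, Prod.snd_neg],
    ?_, ?_⟩
  · rw [neg_smul, h3, mul_neg, mul_neg, map_neg, neg_add]
  · rw [neg_smul, h4, mul_neg, mul_neg, map_neg, neg_add]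

theorem mul (H : ActsBy A r ρ) (H' : ActsBy A r' ρ') : ActsBy A (r * r') (ρ * ρ') := by
  obtain ⟨a, b, X, Y, h1, h2, h3, h4⟩ := H
  obtain ⟨a', b', X', Y', h1', h2', h3', h4'⟩ := H'
  refine ⟨a * a', b * b', X * constMatrix ρ' + a • X', Y * constMatrix ρ' + b • Y',
    by rw [map_mul, h1, h1', Prod.fst_mul], by rw [map_mul, h2, h2', Prod.snd_mul], ?_, ?_⟩
  · rw [mul_smul, h3', smul_add, map_mul, ← Matrix.smul_mul, h3, add_mul, mul_add,
      ← mul_assoc (A 0), map_mul _ (A 0 * ρ), mul_assoc, Matrix.mul_smul, add_assoc]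
  · rw [mul_smul, h4', smul_add, map_mul, ← Matrix.smul_mul, h4, add_mul, mul_add,
      ← mul_assoc (A 1), map_mul _ (A 1 * ρ), mul_assoc, Matrix.mul_smul, add_assoc]

/-- This is the injectivity of `ℤⁿ → H⁰(E(-1))`: if `A₁ ρ` and `A₂ ρ` vanish in the cokernels over
the two charts, then `t⁻¹ ρ` is a coboundary in `H¹(𝒪(-2)ⁿ)`, hence zero. -/
theorem eq_zero (hf : f ≠ 0) (hA : Det A = f) (H : ActsBy A (0 : Chart₀ f × Chart₁ f) ρ) :
    ρ = 0 := by
  obtain ⟨a, b, X, Y, h1, h2, h3, h4⟩ := H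
  obtain ⟨c, rfl⟩ := Ideal.mem_span_singleton.1 (Ideal.Quotient.eq_zero_iff_mem.1 h1)
  obtain ⟨d, rfl⟩ := Ideal.mem_span_singleton.1 (Ideal.Quotient.eq_zero_iff_mem.1 h2)
  -- A multiple of `f` lies in the image of the pencil through the adjugate, so it can be absorbed
  -- into the correction terms.
  set X' := c • (pencil₀ A).adjugate * constMatrix (A 0) - X with hX
  set Y' := d • (pencil₁ A).adjugate * constMatrix (A 1) - Y with hY
  have h3' : constMatrix (A 0 * ρ) = pencil₀ A * X' := by
    rw [hX, mul_sub, ← mul_assoc, Matrix.mul_smul, pencil₀_mul_adjugate hA, smul_smul,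
      Matrix.smul_mul, one_mul, mul_comm c, h3, add_sub_cancel_right]
  have h4' : constMatrix (A 1 * ρ) = pencil₁ A * Y' := by
    rw [hY, mul_sub, ← mul_assoc, Matrix.mul_smul, pencil₁_mul_adjugate hA, smul_smul,
      Matrix.smul_mul, one_mul, mul_comm d, h4, add_sub_cancel_right]
  have e0 := mapMatrix_constMatrix₀ (A 0 * ρ)
  have e1 := mapMatrix_constMatrix₁ (A 1 * ρ)
  rw [map_mul LaurentPolynomial.C.mapMatrix] at e0 e1
  have key : (LaurentPolynomial.T (-1) : ℤ[T;T⁻¹]) • LaurentPolynomial.C.mapMatrix ρ =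
      Polynomial.toLaurent.mapMatrix X' +
        (LaurentPolynomial.T (-2) : ℤ[T;T⁻¹]) • fromS.mapMatrix Y' := by
    apply map_pencil₀_mul_cancel hf hA
    have hT : (LaurentPolynomial.T (-2) : ℤ[T;T⁻¹]) =
        LaurentPolynomial.T (-1) * LaurentPolynomial.T (-1) := by
      rw [← LaurentPolynomial.T_add]; rfl
    have hT' : (LaurentPolynomial.T (-1) : ℤ[T;T⁻¹]) * LaurentPolynomial.T 1 = 1 := by
      rw [← LaurentPolynomial.T_add]; simp
    have hY'' : (LaurentPolynomial.T (-1) : ℤ[T;T⁻¹]) •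
        (Polynomial.toLaurent.mapMatrix (pencil₀ A) * fromS.mapMatrix Y') =
        LaurentPolynomial.C.mapMatrix (A 1) * LaurentPolynomial.C.mapMatrix ρ := by
      rw [← e1, h4', map_mul fromS.mapMatrix, map_pencil₁, Matrix.smul_mul]
    rw [mul_add, ← map_mul, ← h3', Matrix.mul_smul, Matrix.mul_smul, hT, mul_smul, hY'', e0,
      map_pencil₀, add_mul, smul_add, Matrix.smul_mul, smul_smul, hT', one_smul]
  ext i j
  -- Only `ρ` contributes to `t⁻¹`: `X'` has exponents at least `0`, and `t⁻² Y'(t⁻¹)` has exponents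
  -- at most `-2`.
  have hij : (LaurentPolynomial.T (-1) * LaurentPolynomial.C (ρ i j)).coeff (-1) =
      (Polynomial.toLaurent (X' i j) + LaurentPolynomial.T (-2) * fromS (Y' i j)).coeff (-1) :=
    congrArg (fun M => (M i j).coeff (-1)) key
  rwa [coeff_T_mul, coeff_C, AddMonoidAlgebra.coeff_add, Finsupp.add_apply,
    coeff_toLaurent_of_neg _ (by omega), coeff_T_mul, coeff_fromS_of_pos _ (by omega)] at hij

theorem unique (hf : f ≠ 0) (hA : Det A = f) (H : ActsBy A r ρ) (H' : ActsBy A r ρ') :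
    ρ = ρ' := by
  have := H.add H'.neg
  rw [add_neg_cancel] at this
  exact eq_of_sub_eq_zero (by rw [sub_eq_add_neg]; exact this.eq_zero hf hA)

end ActsBy

/-- The matrix `ρ` is the `t⁻¹` coefficient of a cocycle `W` with `L W = a A₁ + t⁻¹ b A₂`, where `L`
is the pencil and `(a, b)` lifts `r`. The other parts of `W` provide the corrections `X` and `Y` in
the two charts. -/
theorem exists_actsBy {f : Form n} {A : Tensor n} (hA : Det A = f) (r : ringR f) :
    ∃ ρ, ActsBy A r.1 ρ := by
  obtain ⟨⟨a, b⟩, hr⟩ := r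
  obtain ⟨a, rfl⟩ := Ideal.Quotient.mk_surjective a
  obtain ⟨b, rfl⟩ := Ideal.Quotient.mk_surjective b
  have hr' : res₀ f (Ideal.Quotient.mk _ a) = res₁ f (Ideal.Quotient.mk _ b) := hr
  rw [res₀, res₁, Ideal.quotientMap_mk, Ideal.quotientMap_mk, Ideal.Quotient.eq,
    Ideal.mem_span_singleton] at hr'
  obtain ⟨g, hg⟩ := hr'
  set L := Polynomial.toLaurent.mapMatrix (pencil₀ A) with hL
  set A₀ : Matrix (Fin n) (Fin n) ℤ[T;T⁻¹] := LaurentPolynomial.C.mapMatrix (A 0) with hA₀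
  set A₁ : Matrix (Fin n) (Fin n) ℤ[T;T⁻¹] := LaurentPolynomial.C.mapMatrix (A 1) with hA₁
  set t := (LaurentPolynomial.T (-1) : ℤ[T;T⁻¹]) with ht
  -- This is `L⁻¹ (a A₁ + t⁻¹ b A₂)`, written without denominators by means of `a - b = f g` and `L
  -- adj(L) = f`.
  set W : Matrix (Fin n) (Fin n) ℤ[T;T⁻¹] :=
    (t * Polynomial.toLaurent a) • 1 - (t * g) • (L.adjugate * A₁) with hW
  choose X ρ Y hXY using fun i j => exists_split_residue (W i j)
  set X : Matrix (Fin n) (Fin n) ℤ[X] := X with hX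
  set Y : Matrix (Fin n) (Fin n) ℤ[X] := Y with hY
  set ρ : Matrix (Fin n) (Fin n) ℤ := ρ with hρ
  have e : W = Polynomial.toLaurent.mapMatrix X + t • LaurentPolynomial.C.mapMatrix ρ +
      (t * t) • fromS.mapMatrix Y := by
    ext1 i j
    rw [hXY, ht, ← LaurentPolynomial.T_add]
    rfl
  have hT : t * LaurentPolynomial.T 1 = 1 := by
    rw [ht, ← LaurentPolynomial.T_add]; simp
  have hLA : t • L = A₀ + t • A₁ := by
    rw [hL, map_pencil₀, smul_add, smul_smul, hT, one_smul]
  have hLadj : L * L.adjugate = Polynomial.toLaurent (eqn₀ f) • 1 := by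
    rw [Matrix.mul_adjugate, ← RingHom.map_det, det_pencil₀ hA]
  have e₁ : L * W = Polynomial.toLaurent a • A₀ + (t * fromS b) • A₁ := by
    have : fromS b = Polynomial.toLaurent a - Polynomial.toLaurent (eqn₀ f) * g := by
      rw [← hg]; ring
    rw [hW, mul_sub, Matrix.mul_smul, Matrix.mul_smul, mul_one, ← mul_assoc, hLadj,
      Matrix.smul_mul, one_mul, mul_comm t, mul_smul, hLA, this]
    module
  have e₂ : L * W = L * Polynomial.toLaurent.mapMatrix X +
      (A₀ * LaurentPolynomial.C.mapMatrix ρ + t • (A₁ * LaurentPolynomial.C.mapMatrix ρ)) +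
      t • (fromS.mapMatrix (pencil₁ A) * fromS.mapMatrix Y) := by
    rw [e, mul_add, mul_add, Matrix.mul_smul, ← Matrix.smul_mul, hLA, add_mul, Matrix.smul_mul,
      Matrix.mul_smul, mul_smul, map_pencil₁, ← hL, ← ht, Matrix.smul_mul]
  set U := a • constMatrix (A 0) - (constMatrix (A 0 * ρ) + pencil₀ A * X) with hU
  set V := b • constMatrix (A 1) - (constMatrix (A 1 * ρ) + pencil₁ A * Y) with hV
  have hU' : Polynomial.toLaurent.mapMatrix U = Polynomial.toLaurent a • A₀ -
      (A₀ * LaurentPolynomial.C.mapMatrix ρ + L * Polynomial.toLaurent.mapMatrix X) := by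
    rw [hU, map_sub, map_add, hA₀, ← map_mul, ← mapMatrix_constMatrix₀, ← mapMatrix_constMatrix₀,
      hL, ← map_mul Polynomial.toLaurent.mapMatrix]
    congr 1
    ext1 i j
    simp
  have hV' : fromS.mapMatrix V = fromS b • A₁ -
      (A₁ * LaurentPolynomial.C.mapMatrix ρ +
        fromS.mapMatrix (pencil₁ A) * fromS.mapMatrix Y) := by
    rw [hV, map_sub, map_add, hA₁, ← map_mul, ← mapMatrix_constMatrix₁, ← mapMatrix_constMatrix₁,
      ← map_mul fromS.mapMatrix]
    congr 1
    ext1 i j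
    simp
  -- Comparing the two expressions for `L W` equates a polynomial in `t` with a polynomial in `t⁻¹`
  -- without constant term. Both defects therefore vanish.
  have hUV : Polynomial.toLaurent.mapMatrix U = -(t • fromS.mapMatrix V) := by
    rw [hU', hV']
    have := e₁.symm.trans e₂
    rw [mul_smul] at this
    rw [smul_sub, smul_add]
    rw [← sub_eq_zero] at this ⊢
    rw [← this]
    abel
  have h0 (i j) : U i j = 0 ∧ V i j = 0 := by
    have hij : Polynomial.toLaurent (U i j) = -(t * fromS (V i j)) :=
      congrArg (fun M => M i j) hUV
    have := eq_zero_of_toLaurent_eq (p := U i j) (q := -V i j) (by rw [hij, map_neg, mul_neg])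
    simpa using this
  exact ⟨ρ, a, b, X, Y, rfl, rfl, sub_eq_zero.1 (Matrix.ext fun i j => (h0 i j).1),
    sub_eq_zero.1 (Matrix.ext fun i j => (h0 i j).2)⟩

/-! ### The balancing map of a tensor -/

/-- The tensor with the two modules exchanged. -/
def transposeTensor (A : Tensor n) : Tensor n := fun i => (A i).transpose

theorem Det_transposeTensor (A : Tensor n) : Det (transposeTensor A) = Det A := by
  rw [Det, ← Matrix.det_transpose, Det]
  rfl

theorem pencil₀_transposeTensor (A : Tensor n) :
    pencil₀ (transposeTensor A) = (pencil₀ A).transpose := rfl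

theorem pencil₁_transposeTensor (A : Tensor n) :
    pencil₁ (transposeTensor A) = (pencil₁ A).transpose := rfl

/-- The balancing map in the chart `x₂ ≠ 0`. -/
def gram₀ (A : Tensor n) : Matrix (Fin n) (Fin n) ℤ[X] :=
  constMatrix (A 0) * (pencil₀ A).adjugate * constMatrix (A 0)

/-- The balancing map in the chart `x₁ ≠ 0`. -/
def gram₁ (A : Tensor n) : Matrix (Fin n) (Fin n) ℤ[X] :=
  constMatrix (A 1) * (pencil₁ A).adjugate * constMatrix (A 1)

theorem gram₀_transposeTensor (A : Tensor n) :
    gram₀ (transposeTensor A) = (gram₀ A).transpose := by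
  rw [gram₀, gram₀, pencil₀_transposeTensor, Matrix.transpose_mul, Matrix.transpose_mul,
    Matrix.adjugate_transpose, ← mul_assoc]
  rfl

theorem gram₁_transposeTensor (A : Tensor n) :
    gram₁ (transposeTensor A) = (gram₁ A).transpose := by
  rw [gram₁, gram₁, pencil₁_transposeTensor, Matrix.transpose_mul, Matrix.transpose_mul,
    Matrix.adjugate_transpose, ← mul_assoc]
  rfl

/-- The polar part of the balancing map. -/
def gramPolar (A : Tensor n) : Matrix (Fin n) (Fin n) ℤ[T;T⁻¹] :=
  (LaurentPolynomial.T (-1) : ℤ[T;T⁻¹]) • LaurentPolynomial.C.mapMatrix (A 0) -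
    (LaurentPolynomial.T (-2) : ℤ[T;T⁻¹]) • LaurentPolynomial.C.mapMatrix (A 1)

/-- Since `L₁ = t⁻¹ L`, the factor `tⁿ⁻³ adj(L₁)` equals `t⁻² adj(L)`. Substituting `A₁ = t⁻¹ (L -
A₂)`, the left side is `t⁻²` times `(L - A₂) adj(L) (L - A₂) - A₂ adj(L) A₂ = f (L - 2 A₂) = f (t A₁
- A₂)`. The minus sign is the one built into `polar`. -/
theorem gram_glue {f : Form n} (hf : f ≠ 0) {A : Tensor n} (hA : Det A = f) :
    Polynomial.toLaurent.mapMatrix (gram₀ A) -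
      (LaurentPolynomial.T ((n : ℤ) - 3) : ℤ[T;T⁻¹]) • fromS.mapMatrix (gram₁ A) =
    Polynomial.toLaurent (eqn₀ f) • gramPolar A := by
  have hLadj : Polynomial.toLaurent.mapMatrix (pencil₀ A) *
      Polynomial.toLaurent.mapMatrix (pencil₀ A).adjugate =
        Polynomial.toLaurent (eqn₀ f) • 1 := by
    rw [RingHom.map_adjugate, Matrix.mul_adjugate, ← RingHom.map_det, det_pencil₀ hA]
  have hadjL : Polynomial.toLaurent.mapMatrix (pencil₀ A).adjugate *
      Polynomial.toLaurent.mapMatrix (pencil₀ A) =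
        Polynomial.toLaurent (eqn₀ f) • 1 := by
    rw [RingHom.map_adjugate, Matrix.adjugate_mul, ← RingHom.map_det, det_pencil₀ hA]
  -- After multiplication by `L` both sides become `t⁻² f(t, 1)` times the identity, because `f(1,
  -- t⁻¹) = t⁻ⁿ f(t, 1)`.
  have hadj : (LaurentPolynomial.T ((n : ℤ) - 3) : ℤ[T;T⁻¹]) •
      fromS.mapMatrix (pencil₁ A).adjugate = (LaurentPolynomial.T (-2) : ℤ[T;T⁻¹]) •
        Polynomial.toLaurent.mapMatrix (pencil₀ A).adjugate := by
    apply map_pencil₀_mul_cancel hf hA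
    have h1 : Polynomial.toLaurent.mapMatrix (pencil₀ A) =
        (LaurentPolynomial.T 1 : ℤ[T;T⁻¹]) • fromS.mapMatrix (pencil₁ A) := by
      rw [map_pencil₁, smul_smul, ← LaurentPolynomial.T_add]
      simp
    have h2 : fromS.mapMatrix (pencil₁ A) * fromS.mapMatrix (pencil₁ A).adjugate =
        fromS (eqn₁ f) • 1 := by
      rw [RingHom.map_adjugate, Matrix.mul_adjugate, ← RingHom.map_det, det_pencil₁ hA]
    rw [Matrix.mul_smul, Matrix.mul_smul, hLadj, h1, Matrix.smul_mul, h2, fromS_eqn₁, smul_smul,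
      smul_smul, smul_smul, ← mul_assoc, ← LaurentPolynomial.T_add,
      ← LaurentPolynomial.T_add]
    congr 3
    ring
  have h0 : LaurentPolynomial.C.mapMatrix (A 0) = (LaurentPolynomial.T (-1) : ℤ[T;T⁻¹]) •
      (Polynomial.toLaurent.mapMatrix (pencil₀ A) - LaurentPolynomial.C.mapMatrix (A 1)) := by
    rw [map_pencil₀, add_sub_cancel_right, smul_smul, ← LaurentPolynomial.T_add]
    simp
  have hT : (LaurentPolynomial.T (-2) : ℤ[T;T⁻¹]) =
      LaurentPolynomial.T (-1) * LaurentPolynomial.T (-1) := by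
    rw [← LaurentPolynomial.T_add]; rfl
  rw [gram₀, gram₁, map_mul, map_mul, map_mul fromS.mapMatrix, map_mul fromS.mapMatrix,
    mapMatrix_constMatrix₀, mapMatrix_constMatrix₁, ← Matrix.smul_mul, ← Matrix.mul_smul, hadj,
    gramPolar, h0, hT]
  simp only [Matrix.smul_mul, Matrix.mul_smul, sub_mul, mul_sub, hLadj, hadjL, one_mul, mul_one,
    smul_sub, mul_assoc, smul_smul]
  simp only [← mul_assoc]
  module

theorem mem_moduleI_of_glue {f : Form n} {p q : ℤ[X]} {h : ℤ[T;T⁻¹]}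
    (H : Polynomial.toLaurent p - LaurentPolynomial.T ((n : ℤ) - 3) * fromS q =
      Polynomial.toLaurent (eqn₀ f) * h) :
    ((Ideal.Quotient.mk _ p, Ideal.Quotient.mk _ q) : Chart₀ f × Chart₁ f) ∈ moduleI f := by
  change res₀ f (Ideal.Quotient.mk _ p) = Ideal.Quotient.mk _ (LaurentPolynomial.T ((n : ℤ) - 3)) *
      res₁ f (Ideal.Quotient.mk _ q)
  rw [res₀, res₁, Ideal.quotientMap_mk, Ideal.quotientMap_mk, ← map_mul, Ideal.Quotient.eq,
    Ideal.mem_span_singleton, H]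
  exact Dvd.intro _ rfl

theorem constMatrix_mulVec (ρ : Matrix (Fin n) (Fin n) ℤ) (y : Fin n → ℤ) :
    (fun i => Polynomial.C ((ρ.mulVec y) i)) =
      (constMatrix ρ).mulVec (fun i => Polynomial.C (y i)) := by
  ext1 i
  exact RingHom.map_mulVec Polynomial.C ρ y i

theorem map_dotProduct_mulVec (φ : ℤ[X] →+* ℤ[T;T⁻¹])
    (hφ : ∀ a, φ (Polynomial.C a) = LaurentPolynomial.C a) (B : Matrix (Fin n) (Fin n) ℤ[X])
    (x y : Fin n → ℤ) :
    φ ((fun i => Polynomial.C (x i)) ⬝ᵥ B.mulVec fun i => Polynomial.C (y i)) =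
      (fun i => LaurentPolynomial.C (x i)) ⬝ᵥ
        (φ.mapMatrix B).mulVec fun i => LaurentPolynomial.C (y i) := by
  have hC (x : Fin n → ℤ) : φ ∘ (fun i => Polynomial.C (x i)) =
      fun i => LaurentPolynomial.C (x i) := funext fun i => hφ (x i)
  have hB : φ ∘ (B.mulVec fun i => Polynomial.C (y i)) =
      (φ.mapMatrix B).mulVec fun i => LaurentPolynomial.C (y i) := by
    rw [← hC]
    exact funext fun i => RingHom.map_mulVec φ B _ i
  rw [RingHom.map_dotProduct, hC, hB]

/-- The section `m ⊗ n` of `𝒪(n-3)` on `T_f`. -/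
def pairingSection (f : Form n) (A : Tensor n) (x y : Fin n → ℤ) : Chart₀ f × Chart₁ f :=
  (Ideal.Quotient.mk _ ((fun i => Polynomial.C (x i)) ⬝ᵥ
      (gram₀ A).mulVec fun i => Polynomial.C (y i)),
    Ideal.Quotient.mk _ ((fun i => Polynomial.C (x i)) ⬝ᵥ
      (gram₁ A).mulVec fun i => Polynomial.C (y i)))

theorem pairingSection_isLift {f : Form n} (hf : f ≠ 0) {A : Tensor n} (hA : Det A = f)
    (x y : Fin n → ℤ) : IsLift f (pairingSection f A x y)
      ((fun i => Polynomial.C (x i)) ⬝ᵥ (gram₀ A).mulVec fun i => Polynomial.C (y i))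
      ((fun i => Polynomial.C (x i)) ⬝ᵥ (gram₁ A).mulVec fun i => Polynomial.C (y i))
      ((fun i => LaurentPolynomial.C (x i)) ⬝ᵥ
        (gramPolar A).mulVec fun i => LaurentPolynomial.C (y i)) := by
  refine ⟨rfl, rfl, ?_⟩
  have h0 := map_dotProduct_mulVec Polynomial.toLaurent (by simp) (gram₀ A) x y
  have h1 := map_dotProduct_mulVec fromS fromS_C (gram₁ A) x y
  rw [h0, h1, ← smul_eq_mul, ← smul_eq_mul, ← dotProduct_smul, ← dotProduct_smul,
    ← Matrix.smul_mulVec, ← Matrix.smul_mulVec, ← dotProduct_sub, ← Matrix.sub_mulVec,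
    gram_glue hf hA]

theorem pairingSection_mem {f : Form n} (hf : f ≠ 0) {A : Tensor n} (hA : Det A = f)
    (x y : Fin n → ℤ) : pairingSection f A x y ∈ moduleI f :=
  mem_moduleI_of_glue (pairingSection_isLift hf hA x y).2.2

/-- Transposing the tensor exchanges the two arguments, so every statement about the left variable
follows from the one about the right variable. -/
theorem pairingSection_transpose (f : Form n) (A : Tensor n) (x y : Fin n → ℤ) :
    pairingSection f (transposeTensor A) y x = pairingSection f A x y := by
  rw [pairingSection, pairingSection, gram₀_transposeTensor, gram₁_transposeTensor, Matrix.mulVec_transpose,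
    Matrix.mulVec_transpose, dotProduct_comm, dotProduct_comm _ (Matrix.vecMul _ (gram₁ A)),
    ← Matrix.dotProduct_mulVec, ← Matrix.dotProduct_mulVec]

theorem pairingSection_add_right (f : Form n) (A : Tensor n) (x y y' : Fin n → ℤ) :
    pairingSection f A x (y + y') = pairingSection f A x y + pairingSection f A x y' := by
  have h : (fun i => Polynomial.C ((y + y') i)) =
      (fun i => Polynomial.C (y i)) + (fun i => Polynomial.C (y' i)) := by
    ext1 i; simp
  rw [pairingSection, h, Matrix.mulVec_add, dotProduct_add, map_add, Matrix.mulVec_add, dotProduct_add,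
    map_add]
  rfl

theorem pairingSection_add_left (f : Form n) (A : Tensor n) (x x' y : Fin n → ℤ) :
    pairingSection f A (x + x') y = pairingSection f A x y + pairingSection f A x' y := by
  rw [← pairingSection_transpose, pairingSection_add_right, pairingSection_transpose, pairingSection_transpose]

/-- Replacing `A₁ ρ` by `a A₁ - L X` in `A₁ adj(L) A₁ ρ` changes the result from `a` times the
pairing only by `A₁ adj(L) L X = f A₁ X`, which is zero on `T_f`. The other chart is the same. -/
theorem pairingSection_mulVec_right {f : Form n} {A : Tensor n} (hA : Det A = f)
    {r : Chart₀ f × Chart₁ f} {ρ : Matrix (Fin n) (Fin n) ℤ} (H : ActsBy A r ρ)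
    (x y : Fin n → ℤ) : pairingSection f A x (ρ.mulVec y) = r * pairingSection f A x y := by
  obtain ⟨a, b, X, Y, h1, h2, h3, h4⟩ := H
  have e0 : gram₀ A * constMatrix ρ = a • gram₀ A - eqn₀ f • (constMatrix (A 0) * X) := by
    rw [gram₀, mul_assoc _ _ (constMatrix ρ), ← map_mul, eq_sub_of_add_eq h3.symm, mul_sub,
      Matrix.mul_smul, mul_assoc _ _ (pencil₀ A * X), ← mul_assoc _ (pencil₀ A),
      Matrix.adjugate_mul, det_pencil₀ hA, Matrix.smul_mul, one_mul, Matrix.mul_smul]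
  have e1 : gram₁ A * constMatrix ρ = b • gram₁ A - eqn₁ f • (constMatrix (A 1) * Y) := by
    rw [gram₁, mul_assoc _ _ (constMatrix ρ), ← map_mul, eq_sub_of_add_eq h4.symm, mul_sub,
      Matrix.mul_smul, mul_assoc _ _ (pencil₁ A * Y), ← mul_assoc _ (pencil₁ A),
      Matrix.adjugate_mul, det_pencil₁ hA, Matrix.smul_mul, one_mul, Matrix.mul_smul]
  rw [pairingSection, constMatrix_mulVec, Matrix.mulVec_mulVec, Matrix.mulVec_mulVec, e0, e1]
  refine Prod.ext ?_ ?_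
  · rw [Prod.fst_mul, ← h1]
    change _ = Ideal.Quotient.mk _ a * Ideal.Quotient.mk _ _
    rw [← map_mul, Ideal.Quotient.eq, Matrix.sub_mulVec, dotProduct_sub, Matrix.smul_mulVec,
      Matrix.smul_mulVec, dotProduct_smul, dotProduct_smul, smul_eq_mul, smul_eq_mul,
      sub_sub_cancel_left, neg_mem_iff]
    exact Ideal.mul_mem_right _ _ (Ideal.mem_span_singleton_self _)
  · rw [Prod.snd_mul, ← h2]
    change _ = Ideal.Quotient.mk _ b * Ideal.Quotient.mk _ _
    rw [← map_mul, Ideal.Quotient.eq, Matrix.sub_mulVec, dotProduct_sub, Matrix.smul_mulVec,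
      Matrix.smul_mulVec, dotProduct_smul, dotProduct_smul, smul_eq_mul, smul_eq_mul,
      sub_sub_cancel_left, neg_mem_iff]
    exact Ideal.mul_mem_right _ _ (Ideal.mem_span_singleton_self _)

theorem polar_principal (a b : ℤ) : polar (LaurentPolynomial.T (-1) * LaurentPolynomial.C a -
    LaurentPolynomial.T (-2) * LaurentPolynomial.C b) = ![a, b] := by
  have h (k : ℤ) : (LaurentPolynomial.T (-1) * LaurentPolynomial.C a -
      LaurentPolynomial.T (-2) * LaurentPolynomial.C b : ℤ[T;T⁻¹]).coeff k =
      (if k = -1 then a else 0) - if k = -2 then b else 0 := by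
    rw [AddMonoidAlgebra.coeff_sub, Finsupp.sub_apply, coeff_T_mul, coeff_T_mul, coeff_C, coeff_C]
    congr 2 <;> exact propext (by omega)
  ext i
  fin_cases i
  · exact (h (-1)).trans (show _ = a by simp)
  · exact (congrArg Neg.neg (h (-2))).trans (show _ = b by simp)

/-! ### The based balanced pair of a tensor -/

/-- The action of `R_f` on the module of a tensor. -/
def actionHom {f : Form n} (hf : f ≠ 0) (A : TensorOfDet f) :
    ringR f →+* Matrix (Fin n) (Fin n) ℤ where
  toFun r := (exists_actsBy A.2 r).choose
  map_one' := (exists_actsBy A.2 1).choose_spec.unique hf A.2 ActsBy.one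
  map_mul' r s := (exists_actsBy A.2 (r * s)).choose_spec.unique hf A.2
    ((exists_actsBy A.2 r).choose_spec.mul (exists_actsBy A.2 s).choose_spec)
  map_zero' := (exists_actsBy A.2 0).choose_spec.eq_zero hf A.2
  map_add' r s := (exists_actsBy A.2 (r + s)).choose_spec.unique hf A.2
    ((exists_actsBy A.2 r).choose_spec.add (exists_actsBy A.2 s).choose_spec)

theorem actionHom_actsBy {f : Form n} (hf : f ≠ 0) (A : TensorOfDet f) (r : ringR f) :
    ActsBy A.1 r.1 (actionHom hf A r) :=
  (exists_actsBy A.2 r).choose_spec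

/-- The module `ℤⁿ` over `R_f` attached to a tensor. -/
structure TensorModule {f : Form n} (hf : f ≠ 0) (A : TensorOfDet f) : Type u where
  vec : Fin n → ℤ

namespace TensorModule

variable {f : Form n} {hf : f ≠ 0} {A : TensorOfDet f}

/-- The underlying vector. -/
def equivVec : TensorModule.{u} hf A ≃ (Fin n → ℤ) := ⟨vec, mk, fun _ => rfl, fun _ => rfl⟩

instance : AddCommGroup (TensorModule.{u} hf A) := equivVec.addCommGroup

theorem add_vec (x y : TensorModule.{u} hf A) : (x + y).vec = x.vec + y.vec := rfl

theorem zero_vec : (0 : TensorModule.{u} hf A).vec = 0 := rfl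

@[ext]
theorem ext {x y : TensorModule.{u} hf A} (h : x.vec = y.vec) : x = y := by
  cases x; cases y; congr

instance : SMul (ringR f) (TensorModule.{u} hf A) where
  smul r x := ⟨(actionHom hf A r).mulVec x.vec⟩

theorem smul_vec (r : ringR f) (x : TensorModule.{u} hf A) :
    (r • x).vec = (actionHom hf A r).mulVec x.vec := rfl

instance : Module (ringR f) (TensorModule.{u} hf A) where
  one_smul x := ext <| by rw [smul_vec, map_one, Matrix.one_mulVec]
  mul_smul r s x := ext <| by rw [smul_vec, smul_vec, smul_vec, map_mul, Matrix.mulVec_mulVec]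
  smul_zero r := ext <| by rw [smul_vec, zero_vec, Matrix.mulVec_zero]
  smul_add r x y := ext <| by
    rw [smul_vec, add_vec, add_vec, smul_vec, smul_vec, Matrix.mulVec_add]
  add_smul r s x := ext <| by
    rw [smul_vec, add_vec, smul_vec, smul_vec, map_add, Matrix.add_mulVec]
  zero_smul x := ext <| by rw [smul_vec, zero_vec, map_zero, Matrix.zero_mulVec]

/-- The standard basis. -/
def basis : Module.Basis (Fin n) ℤ (TensorModule.{u} hf A) :=
  Module.Basis.ofEquivFun
    (AddEquiv.toIntLinearEquiv { equivVec (hf := hf) (A := A) with map_add' := add_vec })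

theorem basis_vec (i : Fin n) : (basis (hf := hf) (A := A) i).vec = Pi.single i 1 := by
  have : basis (hf := hf) (A := A) i = equivVec.symm (Pi.single i 1) := by
    rw [basis, Module.Basis.coe_ofEquivFun]
    rfl
  rw [this]
  rfl

end TensorModule

/-- The transposed tensor. -/
def TensorOfDet.transpose {f : Form n} (A : TensorOfDet f) : TensorOfDet f :=
  ⟨transposeTensor A.1, (Det_transposeTensor A.1).trans A.2⟩

/-- The balancing map of a tensor, as a bilinear map. -/
def tensorBilin {f : Form n} (hf : f ≠ 0) (A : TensorOfDet f) :
    TensorModule.{u} hf A.transpose →ₗ[ringR f] TensorModule.{u} hf A →ₗ[ringR f] moduleI f :=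
  LinearMap.mk₂ (ringR f)
    (fun x y => ⟨pairingSection f A.1 x.vec y.vec, pairingSection_mem hf A.2 _ _⟩)
    (fun x x' y => Subtype.ext <| by
      rw [Submodule.coe_add]
      dsimp only
      rw [TensorModule.add_vec, pairingSection_add_left])
    (fun r x y => Subtype.ext <| by
      rw [Submodule.coe_smul]
      dsimp only
      -- `R_f` acts on the left factor through the transposed tensor, so linearity on the right for
      -- that tensor is what is needed.
      rw [TensorModule.smul_vec, ← pairingSection_transpose, ← pairingSection_transpose f A.1]
      exact pairingSection_mulVec_right A.transpose.2 (actionHom_actsBy hf A.transpose r) _ _)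
    (fun x y y' => Subtype.ext <| by
      rw [Submodule.coe_add]
      dsimp only
      rw [TensorModule.add_vec, pairingSection_add_right])
    (fun r x y => Subtype.ext <| by
      rw [Submodule.coe_smul]
      dsimp only
      rw [TensorModule.smul_vec]
      exact pairingSection_mulVec_right A.2 (actionHom_actsBy hf A r) _ _)

/-- The balancing map of a tensor. -/
def tensorPairing {f : Form n} (hf : f ≠ 0) (A : TensorOfDet f) :
    TensorModule.{u} hf A.transpose ⊗[ringR f] TensorModule.{u} hf A →ₗ[ringR f] moduleI f :=
  TensorProduct.lift (tensorBilin hf A)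

theorem matrices_tensorPairing {f : Form n} (hf : f ≠ 0) (A : TensorOfDet f) :
    matrices hf (tensorPairing.{u} hf A) TensorModule.basis TensorModule.basis = A.1 := by
  have key (j k : Fin n) : toV hf (tensorPairing.{u} hf A
      (TensorModule.basis j ⊗ₜ[ringR f] TensorModule.basis k)) = ![A.1 0 j k, A.1 1 j k] := by
    rw [toV_eq hf _ (pairingSection_isLift hf A.2 _ _), TensorModule.basis_vec, TensorModule.basis_vec,
      ← polar_principal]
    have hs (j : Fin n) : (fun i => LaurentPolynomial.C ((Pi.single j 1 : Fin n → ℤ) i)) =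
        (Pi.single j 1 : Fin n → ℤ[T;T⁻¹]) := by
      ext1 i
      rcases eq_or_ne i j with rfl | h
      · simp
      · simp [h]
    rw [hs, hs, single_one_dotProduct, Matrix.mulVec_single_one]
    rfl
  ext i j k
  refine (congrFun (key j k) i).trans ?_
  fin_cases i <;> rfl

/-- The based balanced pair of a tensor. -/
def tensorPair {f : Form n} (hf : f ≠ 0) (A : TensorOfDet f) : BasedBalancedPair.{u} f hf where
  M := TensorModule.{u} hf A.transpose
  N := TensorModule.{u} hf A
  basisM := TensorModule.basis
  basisN := TensorModule.basis
  pairing := tensorPairing hf A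
  det_eq := by rw [matrices_tensorPairing, A.2]

theorem tensor_tensorPair {f : Form n} (hf : f ≠ 0) (A : TensorOfDet f) :
    (tensorPair.{u} hf A).tensor = A :=
  Subtype.ext (matrices_tensorPairing hf A)

/-! ### Sections of `𝒪(n-3)` are determined by the canonical map and the action of `R_f` -/

instance instModuleModuleI (f : Form n) : Module (ringR f) (moduleI f) := Submodule.module _

instance instSMulModuleI (f : Form n) : SMul (ringR f) (moduleI f) :=
  (instModuleModuleI f).toSMul

theorem coeff_eqn₀_of_lt (f : Form n) {k : ℕ} (hk : n < k) : (eqn₀ f).coeff k = 0 := by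
  have hf := (MvPolynomial.mem_homogeneousSubmodule _ _).1 f.2
  rw [eqn₀, MvPolynomial.aeval_def, MvPolynomial.eval₂_eq', Polynomial.finsetSum_coeff]
  refine Finset.sum_eq_zero fun d hd => ?_
  have h1 : d 0 + d 1 = n := by
    have := hf (MvPolynomial.mem_support_iff.1 hd)
    simpa [Finsupp.weight_apply, Finsupp.sum_fintype] using this
  simp only [Fin.prod_univ_two, Matrix.cons_val_zero, Matrix.cons_val_one, one_pow, mul_one,
    eq_intCast, Polynomial.coeff_intCast_mul, Polynomial.coeff_X_pow]
  rw [if_neg (by omega), mul_zero]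

/-- In `h = p' + (polar terms) + t⁻³ q'(t⁻¹)` the outer terms can be removed by changing the lifts:
`f(t, 1) p'` goes into `p`, and `f(t, 1) t⁻³ q' = tⁿ⁻³ f(1, t⁻¹) q'` goes into `q`. -/
theorem exists_normalized_lift {f : Form n} (hf : f ≠ 0) (x : moduleI f) :
    ∃ p q : ℤ[X], IsLift f x.1 p q (LaurentPolynomial.C (toV hf x 0) * LaurentPolynomial.T (-1) -
      LaurentPolynomial.C (toV hf x 1) * LaurentPolynomial.T (-2)) := by
  obtain ⟨p, q, h, H⟩ := exists_isLift f x
  have hx := toV_eq hf x H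
  obtain ⟨h1, h2, h3⟩ := H
  obtain ⟨p', q', e⟩ := exists_split_polar h
  rw [← hx] at e
  refine ⟨p - eqn₀ f * p', q + eqn₁ f * q', ?_, ?_, ?_⟩
  · rw [← h1, Ideal.Quotient.eq, sub_sub_cancel_left, neg_mem_iff]
    exact Ideal.mul_mem_right _ _ (Ideal.mem_span_singleton_self _)
  · rw [← h2, Ideal.Quotient.eq, add_sub_cancel_left]
    exact Ideal.mul_mem_right _ _ (Ideal.mem_span_singleton_self _)
  · have hT : (LaurentPolynomial.T ((n : ℤ) - 3) : ℤ[T;T⁻¹]) * LaurentPolynomial.T (-(n : ℤ)) =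
        LaurentPolynomial.T (-3) := by
      rw [← LaurentPolynomial.T_add]
      congr 1
      ring
    rw [map_sub, map_add, map_mul, map_mul, fromS_eqn₁]
    rw [e] at h3
    linear_combination h3 - Polynomial.toLaurent (eqn₀ f) * fromS q' * hT

/-- Splitting `t⁻ᵐ⁻¹ f(t, 1)` into exponents `≥ 0` and `< 0` gives functions on the two charts whose
difference is divisible by `f`. The constant term is put into `a`, so that `b` vanishes at `s = 0`;
this removes unwanted terms when the polar part of a multiple is computed. -/
theorem exists_testFunction (f : Form n) (m : ℕ) : ∃ (r : ringR f) (a b : ℤ[X]),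
    Ideal.Quotient.mk _ a = r.1.1 ∧ Ideal.Quotient.mk _ b = r.1.2 ∧
    Polynomial.toLaurent a - fromS b =
      Polynomial.toLaurent (eqn₀ f) * LaurentPolynomial.T (-1 - (m : ℤ)) ∧ b.coeff 0 = 0 := by
  obtain ⟨a, q, e⟩ := exists_split
    (Polynomial.toLaurent (eqn₀ f) * LaurentPolynomial.T (-1 - (m : ℤ)))
  have key : Polynomial.toLaurent a - fromS (-(Polynomial.X * q)) =
      Polynomial.toLaurent (eqn₀ f) * LaurentPolynomial.T (-1 - (m : ℤ)) := by
    rw [map_neg, map_mul, fromS_X, e]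
    ring
  refine ⟨⟨(Ideal.Quotient.mk _ a, Ideal.Quotient.mk _ (-(Polynomial.X * q))), ?_⟩, a,
    -(Polynomial.X * q), rfl, rfl, key, by simp⟩
  change res₀ f (Ideal.Quotient.mk _ a) = res₁ f (Ideal.Quotient.mk _ _)
  rw [res₀, res₁, Ideal.quotientMap_mk, Ideal.quotientMap_mk, Ideal.Quotient.eq,
    Ideal.mem_span_singleton, key]
  exact Dvd.intro _ rfl

/-- The function on `T_f` which is the integral part of `t⁻ᵐ⁻¹ f(t, 1)` in the chart `x₂ ≠ 0`. -/
def testFunction (f : Form n) (m : ℕ) : ringR f := (exists_testFunction f m).choose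

/-- The values of the canonical map at the multiples of a section give the coefficients of a lift of
this section. -/
theorem exists_lift_of_testFunction {f : Form n} (hf : f ≠ 0) (x : moduleI f) :
    ∃ p q : ℤ[X], IsLift f x.1 p q (LaurentPolynomial.C (toV hf x 0) * LaurentPolynomial.T (-1) -
      LaurentPolynomial.C (toV hf x 1) * LaurentPolynomial.T (-2)) ∧
      (∀ m, n ≤ m → p.coeff m = 0) ∧
      (∀ m, toV hf (testFunction f m • x) 0 = p.coeff m) ∧
      (∀ m, toV hf (testFunction f m • x) 1 =
        (eqn₀ f).coeff m * toV hf x 0 - (Polynomial.X * p).coeff m) := by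
  obtain ⟨p, q, H⟩ := exists_normalized_lift hf x
  set h : ℤ[T;T⁻¹] := LaurentPolynomial.C (toV hf x 0) * LaurentPolynomial.T (-1) -
      LaurentPolynomial.C (toV hf x 1) * LaurentPolynomial.T (-2) with hh
  have coeff_mul_h (g : ℤ[T;T⁻¹]) (k : ℤ) : (g * h).coeff k =
      toV hf x 0 * g.coeff (k + 1) - toV hf x 1 * g.coeff (k + 2) := by
    have : g * h = LaurentPolynomial.C (toV hf x 0) * (LaurentPolynomial.T (-1) * g) -
        LaurentPolynomial.C (toV hf x 1) * (LaurentPolynomial.T (-2) * g) := by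
      rw [hh]; ring
    rw [this, AddMonoidAlgebra.coeff_sub, Finsupp.sub_apply, coeff_C_mul, coeff_C_mul, coeff_T_mul,
      coeff_T_mul, sub_neg_eq_add, sub_neg_eq_add]
  refine ⟨p, q, H, ?_, ?_⟩
  -- Here `p = tⁿ⁻³ q(t⁻¹) + f h`, where the first term has exponents at most `n - 3` and the second
  -- at most `n - 1`.
  · intro m hm
    have h3 := congrArg (fun g => g.coeff (m : ℤ)) H.2.2
    simp only [AddMonoidAlgebra.coeff_sub, Finsupp.sub_apply, coeff_toLaurent, coeff_T_mul,
      coeff_mul_h] at h3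
    rw [coeff_fromS_of_pos _ (by omega), sub_zero] at h3
    have h4 := coeff_toLaurent (eqn₀ f) (m + 1)
    have h5 := coeff_toLaurent (eqn₀ f) (m + 2)
    rw [coeff_eqn₀_of_lt f (by omega)] at h4 h5
    push_cast at h4 h5
    rw [h3, h4, h5, mul_zero, mul_zero, sub_zero]
  · have key (m : ℕ) : toV hf (testFunction f m • x) =
        ![p.coeff m, (eqn₀ f).coeff m * toV hf x 0 - (Polynomial.X * p).coeff m] := by
      obtain ⟨a, b, ha, hb, hab, hb0⟩ := (exists_testFunction f m).choose_spec
      obtain ⟨h1, h2, h3⟩ := H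
      -- From `a p - b tⁿ⁻³ q = b (p - tⁿ⁻³ q) + (a - b) p`, where both summands are divisible by
      -- `f(t, 1)`.
      have H' : IsLift f (testFunction f m • x).1 (a * p) (b * q)
          (fromS b * h + LaurentPolynomial.T (-1 - (m : ℤ)) * Polynomial.toLaurent p) := by
        refine ⟨?_, ?_, ?_⟩
        · rw [map_mul, h1, ha]; rfl
        · rw [map_mul, h2, hb]; rfl
        · rw [map_mul, map_mul]
          linear_combination Polynomial.toLaurent p * hab + fromS b * h3
      have hb1 : (fromS b).coeff (-1) = -(eqn₀ f).coeff m := by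
        have := congrArg (fun g => g.coeff (-1)) hab
        simp only [AddMonoidAlgebra.coeff_sub, Finsupp.sub_apply, mul_comm _ (LaurentPolynomial.T _),
          coeff_T_mul] at this
        rw [coeff_toLaurent_of_neg _ (by omega), sub_sub_cancel, coeff_toLaurent] at this
        linarith
      have hb0' : (fromS b).coeff 0 = 0 := by
        rw [coeff_fromS, neg_zero]
        exact (coeff_toLaurent b 0).trans hb0
      have hb1' : (fromS b).coeff 1 = 0 := coeff_fromS_of_pos _ one_pos
      rw [toV_eq hf _ H']
      ext i
      fin_cases i
      · change (fromS b * h + LaurentPolynomial.T (-1 - (m : ℤ)) * Polynomial.toLaurent p).coeff (-1)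
          = p.coeff m
        rw [AddMonoidAlgebra.coeff_add, Finsupp.add_apply, coeff_mul_h, coeff_T_mul, sub_sub_cancel,
          coeff_toLaurent]
        norm_num [hb0', hb1']
      · change -(fromS b * h + LaurentPolynomial.T (-1 - (m : ℤ)) *
          Polynomial.toLaurent p).coeff (-2) = _ - (Polynomial.X * p).coeff m
        have hp : (Polynomial.toLaurent p).coeff ((m : ℤ) - 1) = (Polynomial.X * p).coeff m := by
          rcases m with _ | m
          · rw [coeff_toLaurent_of_neg _ (by simp), Polynomial.coeff_X_mul_zero]
          · rw [Polynomial.coeff_X_mul, ← coeff_toLaurent]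
            congr 1
            push_cast
            ring
        rw [AddMonoidAlgebra.coeff_add, Finsupp.add_apply, coeff_mul_h, coeff_T_mul, ← hp,
          show (-2 : ℤ) - (-1 - m) = m - 1 by ring]
        norm_num [hb0', hb1]
        ring
    exact ⟨fun m => congrFun (key m) 0, fun m => congrFun (key m) 1⟩

/-! ### Reconstruction of a balanced pair from its matrices -/

section Reconstruction

variable {f : Form n} {hf : f ≠ 0} {M N : Type u} [AddCommGroup M] [AddCommGroup N]
  [Module (ringR f) M] [Module (ringR f) N] (φ : M ⊗[ringR f] N →ₗ[ringR f] moduleI f)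
  (b : Module.Basis (Fin n) ℤ M) (c : Module.Basis (Fin n) ℤ N)

/-- The matrix of multiplication by `r` in a `ℤ`-basis. -/
def smulMatrix (c : Module.Basis (Fin n) ℤ N) (r : ringR f) : Matrix (Fin n) (Fin n) ℤ :=
  Matrix.of fun l k => c.repr (r • c k) l

theorem smul_basis (r : ringR f) (k : Fin n) : r • c k = ∑ l, smulMatrix c r l k • c l :=
  (c.sum_repr (r • c k)).symm

/-- By `R_f`-linearity `φ(u_j ⊗ r w_k) = r φ(u_j ⊗ w_k)`: the action on `N` becomes multiplication
of sections. -/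
theorem matrices_mul_smulMatrix (r : ringR f) (i : Fin 2) (j k : Fin n) :
    (matrices hf φ b c i * smulMatrix c r) j k = toV hf (r • φ (b j ⊗ₜ c k)) i := by
  let ψ : N →+ ℤ := AddMonoidHom.mk' (fun y => toV hf (φ (b j ⊗ₜ y)) i)
    fun y y' => by simp [TensorProduct.tmul_add]
  have h : toV hf (r • φ (b j ⊗ₜ c k)) i = ψ (r • c k) := by
    change _ = toV hf (φ (b j ⊗ₜ (r • c k))) i
    rw [TensorProduct.tmul_smul, map_smul φ]
  rw [h, smul_basis, map_sum, Matrix.mul_apply]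
  refine Finset.sum_congr rfl fun l _ => ?_
  rw [map_zsmul, smul_eq_mul, mul_comm]
  rfl

/-- The pairing is determined by its tensor. The values in `V` of the multiples by test functions
form a generating polynomial `S` that satisfies a linear equation with the pencil as coefficient
matrix, and Cramer's rule solves it. -/
theorem pairing_basis_eq_gram (hA : Det (matrices hf φ b c) = f) (j k : Fin n) :
    (φ (b j ⊗ₜ c k)).1 =
      (Ideal.Quotient.mk _ (gram₀ (matrices hf φ b c) j k),
        Ideal.Quotient.mk _ (gram₁ (matrices hf φ b c) j k)) := by
  set A := matrices hf φ b c with hAdef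
  choose p q H hdeg hp0 hp1 using fun j k => exists_lift_of_testFunction hf (φ (b j ⊗ₜ c k))
  set P : Matrix (Fin n) (Fin n) ℤ[X] := Matrix.of p with hP
  -- The exponent `n` is included: the lifts have degree below `n`, but `f(t, 1)` and `t P`, which
  -- enter `A₂ S`, may have degree `n`.
  set S : Matrix (Fin n) (Fin n) ℤ[X] :=
    ∑ m ∈ Finset.range (n + 1), (Polynomial.X ^ m : ℤ[X]) •
      constMatrix (smulMatrix c (testFunction f m)) with hS
  have hcoeff (B : Matrix (Fin n) (Fin n) ℤ) (j k : Fin n) (m : ℕ) :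
      ((constMatrix B * S) j k).coeff m =
        if m < n + 1 then (B * smulMatrix c (testFunction f m)) j k else 0 := by
    have hterm (i : ℕ) : ((constMatrix B * (Polynomial.X ^ i : ℤ[X]) •
        constMatrix (smulMatrix c (testFunction f i))) j k).coeff m =
        if m = i then (B * smulMatrix c (testFunction f i)) j k else 0 := by
      rw [Matrix.mul_smul, ← map_mul, Matrix.smul_apply, smul_eq_mul, mul_comm]
      exact Polynomial.coeff_C_mul_X_pow _ _ _
    rw [hS, Finset.mul_sum, Matrix.sum_apply, Polynomial.finsetSum_coeff,
      Finset.sum_congr rfl fun i _ => hterm i, Finset.sum_ite_eq]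
    simp only [Finset.mem_range]
  have h0 : constMatrix (A 0) * S = P := by
    ext j k m
    rw [hcoeff, matrices_mul_smulMatrix, hp0, hP, Matrix.of_apply]
    split_ifs with hm
    · rfl
    · exact (hdeg j k m (by omega)).symm
  have h1 : constMatrix (A 1) * S = eqn₀ f • constMatrix (A 0) - (Polynomial.X : ℤ[X]) • P := by
    ext j k m
    rw [hcoeff, matrices_mul_smulMatrix, hp1, Matrix.sub_apply, Matrix.smul_apply,
      Matrix.smul_apply, Polynomial.coeff_sub, smul_eq_mul, smul_eq_mul, RingHom.mapMatrix_apply,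
      Matrix.map_apply, Polynomial.coeff_mul_C, hP, Matrix.of_apply]
    split_ifs with hm
    · rfl
    · obtain ⟨m, rfl⟩ := Nat.exists_eq_succ_of_ne_zero (n := m) (by omega)
      rw [Nat.succ_eq_add_one, Polynomial.coeff_X_mul, hdeg j k m (by omega),
        coeff_eqn₀_of_lt f (by omega), zero_mul, sub_zero]
  -- The terms `t P` coming from `t A₁ S` and from `A₂ S` cancel.
  have hpencil : pencil₀ A * S = eqn₀ f • constMatrix (A 0) := by
    rw [pencil₀, add_mul, Matrix.smul_mul, h0, h1, add_sub_cancel]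
  have hSadj : S = (pencil₀ A).adjugate * constMatrix (A 0) := by
    have := congrArg ((pencil₀ A).adjugate * ·) hpencil
    simp only [← mul_assoc, Matrix.adjugate_mul, Matrix.smul_mul, one_mul, Matrix.mul_smul,
      det_pencil₀ hA] at this
    exact smul_right_injective _ (eqn₀_ne_zero hf) this
  have hgram : P = gram₀ A := by
    rw [← h0, hSadj, gram₀, mul_assoc]
  have hpjk : p j k = gram₀ A j k := congrFun (congrFun hgram j) k
  -- Both lifts have the same polar part and the same component in `t`, so the gluing relation fixes
  -- `tⁿ⁻³ q(t⁻¹)`, and `tⁿ⁻³` is a unit.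
  have hqjk : q j k = gram₁ A j k := by
    apply fromS_injective
    have e1 := (H j k).2.2
    have e2 : Polynomial.toLaurent (gram₀ A j k) -
        LaurentPolynomial.T ((n : ℤ) - 3) * fromS (gram₁ A j k) =
        Polynomial.toLaurent (eqn₀ f) * (LaurentPolynomial.T (-1) * LaurentPolynomial.C (A 0 j k) -
          LaurentPolynomial.T (-2) * LaurentPolynomial.C (A 1 j k)) :=
      congrArg (fun M => M j k) (gram_glue hf hA)
    have e3 : toV hf (φ (b j ⊗ₜ c k)) 0 = A 0 j k := rfl
    have e4 : toV hf (φ (b j ⊗ₜ c k)) 1 = A 1 j k := rfl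
    rw [e3, e4, hpjk] at e1
    have hT : (LaurentPolynomial.T (3 - (n : ℤ)) : ℤ[T;T⁻¹]) * LaurentPolynomial.T ((n : ℤ) - 3) =
        1 := by
      rw [← LaurentPolynomial.T_add]
      simp
    linear_combination (LaurentPolynomial.T (3 - (n : ℤ))) * (e2 - e1) +
      (fromS (gram₁ A j k) - fromS (q j k)) * hT
  rw [← hpjk, ← hqjk]
  exact Prod.ext (H j k).1.symm (H j k).2.1.symm

variable {M' N' : Type u} [AddCommGroup M'] [AddCommGroup N']
  [Module (ringR f) M'] [Module (ringR f) N'] (φ' : M' ⊗[ringR f] N' →ₗ[ringR f] moduleI f)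
  (b' : Module.Basis (Fin n) ℤ M') (c' : Module.Basis (Fin n) ℤ N')

/-- Each product `A i * smulMatrix c r` depends only on the sections `φ(u_j ⊗ w_k)`. Since `Det A =
f ≠ 0`, `A` cancels, so `r` has the same matrix on both modules and the `ℤ`-linear map matching the
bases is `R_f`-linear. -/
theorem exists_linearEquiv_right (hA : Det (matrices hf φ b c) = f)
    (h : ∀ j k, φ (b j ⊗ₜ c k) = φ' (b' j ⊗ₜ c' k)) :
    ∃ β : N ≃ₗ[ringR f] N', ∀ k, β (c k) = c' k := by
  have hσ (r : ringR f) : smulMatrix c r = smulMatrix c' r := by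
    refine eq_of_tensor_mul_eq hf hA fun i => ?_
    have hAA : matrices hf φ b c = matrices hf φ' b' c' := by
      ext i j k
      simp only [matrices, h]
    ext j k
    rw [matrices_mul_smulMatrix, h, hAA, matrices_mul_smulMatrix]
  let β := c.equiv c' (Equiv.refl _)
  have hβ (k) : β (c k) = c' k := c.equiv_apply k c' (Equiv.refl _)
  have hsmul (r : ringR f) (y : N) : β (r • y) = r • β y := by
    have : β.toLinearMap ∘ₗ (DistribSMul.toAddMonoidHom N r).toIntLinearMap =
        (DistribSMul.toAddMonoidHom N' r).toIntLinearMap ∘ₗ β.toLinearMap := by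
      refine c.ext fun k => ?_
      change β (r • c k) = r • β (c k)
      rw [hβ, smul_basis, smul_basis, map_sum, hσ]
      exact Finset.sum_congr rfl fun l _ => by rw [map_zsmul, hβ]
    exact LinearMap.congr_fun this y
  exact ⟨{ β.toAddEquiv with map_smul' := hsmul }, hβ⟩

theorem exists_linearEquiv_left (hA : Det (matrices hf φ b c) = f)
    (h : ∀ j k, φ (b j ⊗ₜ c k) = φ' (b' j ⊗ₜ c' k)) :
    ∃ α : M ≃ₗ[ringR f] M', ∀ j, α (b j) = b' j := by
  refine exists_linearEquiv_right (hf := hf)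
    (φ ∘ₗ (TensorProduct.comm (ringR f) N M).toLinearMap) c b
    (φ' ∘ₗ (TensorProduct.comm (ringR f) N' M').toLinearMap) c' b' ?_ fun j k => ?_
  · rw [← hA, ← Det_transposeTensor (matrices hf φ b c)]
    rfl
  · simpa using h k j

theorem pairing_eq_of_basis (α : M →+ M') (β : N →+ N')
    (h : ∀ j k, φ' (α (b j) ⊗ₜ β (c k)) = φ (b j ⊗ₜ c k)) (x : M) (y : N) :
    φ' (α x ⊗ₜ β y) = φ (x ⊗ₜ y) := by
  rw [← b.sum_repr x, ← c.sum_repr y]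
  simp only [map_sum, map_zsmul, TensorProduct.sum_tmul, TensorProduct.tmul_sum]
  refine Finset.sum_congr rfl fun j _ => Finset.sum_congr rfl fun k _ => ?_
  have hz {M N : Type u} [AddCommGroup M] [AddCommGroup N] [Module (ringR f) M]
      [Module (ringR f) N] (φ : M ⊗[ringR f] N →ₗ[ringR f] moduleI f) (m l : ℤ) (x : M) (y : N) :
      φ ((m • x) ⊗ₜ (l • y)) = m • l • φ (x ⊗ₜ y) := by
    let ψ : M →+ N →+ moduleI f := AddMonoidHom.mk' (fun x => AddMonoidHom.mk'
        (fun y => φ (x ⊗ₜ y)) fun y y' => by rw [TensorProduct.tmul_add, map_add])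
      fun x x' => by
        ext1 y
        change φ _ = φ _ + φ _
        rw [TensorProduct.add_tmul, map_add]
    change ψ (m • x) (l • y) = m • l • ψ x y
    have e : ψ (m • x) = m • ψ x := map_zsmul ψ m x
    rw [e, AddMonoidHom.zsmul_apply, map_zsmul]
  rw [hz, hz, h]

end Reconstruction

theorem BasedBalancedPair.equiv_of_tensor_eq {f : Form n} {hf : f ≠ 0}
    {P Q : BasedBalancedPair.{u} f hf} (h : P.tensor = Q.tensor) : P ≈ Q := by
  have hm : matrices hf P.pairing P.basisM P.basisN = matrices hf Q.pairing Q.basisM Q.basisN :=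
    congrArg Subtype.val h
  have hφ (j k) : P.pairing (P.basisM j ⊗ₜ P.basisN k) = Q.pairing (Q.basisM j ⊗ₜ Q.basisN k) := by
    apply Subtype.ext
    rw [pairing_basis_eq_gram (hf := hf) _ _ _ P.det_eq,
      pairing_basis_eq_gram (hf := hf) _ _ _ Q.det_eq, hm]
  obtain ⟨α, hα⟩ := exists_linearEquiv_left _ _ _ _ _ _ P.det_eq hφ
  obtain ⟨β, hβ⟩ := exists_linearEquiv_right _ _ _ _ _ _ P.det_eq hφ
  refine ⟨α, β, hα, hβ, pairing_eq_of_basis _ P.basisM P.basisN _ (α : P.M →+ Q.M)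
    (β : P.N →+ Q.N) fun j k => ?_⟩
  change Q.pairing (α _ ⊗ₜ β _) = _
  rw [hα, hβ, hφ]

/-! ### Changes of bases and classes -/

theorem exists_changeBasis_eq {M : Type u} [AddCommGroup M] (b b' : Module.Basis (Fin n) ℤ M) :
    ∃ g : GL (Fin n) ℤ, changeBasis g b = b' := by
  refine ⟨⟨(b.toMatrix b').transpose, (b'.toMatrix b).transpose, ?_, ?_⟩, ?_⟩
  · rw [← Matrix.transpose_mul, b'.toMatrix_mul_toMatrix_flip, Matrix.transpose_one]
  · rw [← Matrix.transpose_mul, b.toMatrix_mul_toMatrix_flip, Matrix.transpose_one]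
  · ext j
    rw [changeBasis_apply]
    exact b.sum_toMatrix_smul_self b' j

theorem Det_act_eq (g : GL (Fin n) ℤ × GL (Fin n) ℤ) (A : Tensor n) :
    Det (act g A) = MvPolynomial.C (g.1.val.det * g.2.val.det) * Det A := by
  have hd : ∀ B : Tensor n, Det B = Matrix.det
      ((MvPolynomial.X 0 : MvPolynomial (Fin 2) ℤ) • MvPolynomial.C.mapMatrix (B 0) +
        (MvPolynomial.X 1 : MvPolynomial (Fin 2) ℤ) • MvPolynomial.C.mapMatrix (B 1)) :=
    fun _ => rfl
  have key : (MvPolynomial.X 0 : MvPolynomial (Fin 2) ℤ) •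
        (MvPolynomial.C.mapMatrix (act g A 0) :
          Matrix (Fin n) (Fin n) (MvPolynomial (Fin 2) ℤ)) +
      (MvPolynomial.X 1 : MvPolynomial (Fin 2) ℤ) • MvPolynomial.C.mapMatrix (act g A 1) =
      MvPolynomial.C.mapMatrix g.1.val *
        ((MvPolynomial.X 0 : MvPolynomial (Fin 2) ℤ) • MvPolynomial.C.mapMatrix (A 0) +
          (MvPolynomial.X 1 : MvPolynomial (Fin 2) ℤ) • MvPolynomial.C.mapMatrix (A 1)) *
        MvPolynomial.C.mapMatrix g.2.val.transpose := by
    simp only [act, map_mul, Matrix.mul_add, Matrix.add_mul, Matrix.mul_smul, Matrix.smul_mul]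
  rw [hd, hd, key, Matrix.det_mul, Matrix.det_mul, ← RingHom.map_det, ← RingHom.map_det,
    Matrix.det_transpose, map_mul]
  ring

theorem exists_GL_det_eq_neg_one (hn : 0 < n) : ∃ g : GL (Fin n) ℤ, g.val.det = -1 := by
  obtain ⟨M, h⟩ : ∃ M : Matrix (Fin n) (Fin n) ℤ, M.det = -1 := by
    refine ⟨Matrix.diagonal (Function.update (1 : Fin n → ℤ) ⟨0, hn⟩ (-1)), ?_⟩
    rw [Matrix.det_diagonal, Finset.prod_update_of_mem (Finset.mem_univ _)]
    simp
  refine ⟨Matrix.GeneralLinearGroup.mk'' M (by rw [h]; exact isUnit_one.neg), h⟩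

variable {f : Form n} {hf : f ≠ 0}

/-- If the determinant is `-f`, changing one basis by a matrix of determinant `-1` turns it into
`f`; such a matrix exists because `n > 0`. -/
theorem BalancedPair.exists_based (hn : 0 < n) (P : BalancedPair.{u} f hf) :
    ∃ Q : BasedBalancedPair.{u} f hf, Q.toBalancedPair = P := by
  obtain ⟨b, c, h⟩ := P.det_eq
  rcases h with h | h
  · exact ⟨{ M := P.M, N := P.N, basisM := b, basisN := c, pairing := P.pairing, det_eq := h }, rfl⟩
  · obtain ⟨g, hg⟩ := exists_GL_det_eq_neg_one hn
    have h' : Det (matrices hf P.pairing (changeBasis g b) (changeBasis 1 c)) = f := by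
      rw [matrices_changeBasis P.pairing b c (g, 1), Det_act_eq, h]
      simp [hg]
    exact ⟨{ M := P.M, N := P.N, basisM := _, basisN := _, pairing := P.pairing, det_eq := h' },
      rfl⟩

theorem BasedBalancedPair.tensor_eq_of_equiv {P Q : BasedBalancedPair.{u} f hf} (h : P ≈ Q) :
    P.tensor = Q.tensor := by
  obtain ⟨α, β, hα, hβ, h⟩ := h
  apply Subtype.ext
  ext i j k
  simp only [BasedBalancedPair.tensor, matrices, Matrix.of_apply]
  rw [← hα, ← hβ, h]

theorem BasedBalancedPair.tensor_smul (g : G n) (P : BasedBalancedPair.{u} f hf) :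
    (g • P).tensor = g • P.tensor :=
  Subtype.ext (matrices_changeBasis P.pairing P.basisM P.basisN g.1)

/-- Based balanced pairs are isomorphic after forgetting the bases if and only if their tensors are
in the same class. -/
theorem BasedBalancedPair.toBalancedPair_equiv_iff {P Q : BasedBalancedPair.{u} f hf} :
    P.toBalancedPair ≈ Q.toBalancedPair ↔ ∃ g : G n, g • P.tensor = Q.tensor := by
  constructor
  · intro hPQ
    obtain ⟨α, β, h⟩ : ∃ (α : P.M ≃ₗ[ringR f] Q.M) (β : P.N ≃ₗ[ringR f] Q.N),
        ∀ x y, Q.pairing (α x ⊗ₜ β y) = P.pairing (x ⊗ₜ y) := hPQ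
    -- The bases of `Q` are pulled back along the isomorphisms and compared with those of `P`.
    obtain ⟨g₁, hg₁⟩ := exists_changeBasis_eq P.basisM
      (Q.basisM.map α.symm.toAddEquiv.toIntLinearEquiv)
    obtain ⟨g₂, hg₂⟩ := exists_changeBasis_eq P.basisN
      (Q.basisN.map β.symm.toAddEquiv.toIntLinearEquiv)
    have hA : act (g₁, g₂) P.tensor.1 = Q.tensor.1 := by
      refine (matrices_changeBasis P.pairing P.basisM P.basisN (g₁, g₂)).symm.trans ?_
      ext i j k
      simp only [BasedBalancedPair.tensor, matrices, Matrix.of_apply]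
      rw [hg₁, hg₂]
      refine congrArg (fun x => toV hf x i) ?_
      refine (h (α.symm (Q.basisM j)) (β.symm (Q.basisN k))).symm.trans ?_
      rw [LinearEquiv.apply_symm_apply, LinearEquiv.apply_symm_apply]
    -- Both tensors have determinant `f`, so `f = det g₁ * det g₂ * f`, and the non-zero form `f`
    -- can be cancelled.
    have hdet : g₁.val.det * g₂.val.det = 1 := by
      have hf' : (f : MvPolynomial (Fin 2) ℤ) ≠ 0 := fun h => hf (Subtype.ext h)
      have := Det_act_eq (g₁, g₂) P.tensor.1
      rw [hA, P.tensor.2, Q.tensor.2] at this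
      have h1 := mul_right_cancel₀ hf' ((one_mul _).trans this)
      rw [← MvPolynomial.C_1] at h1
      exact (MvPolynomial.C_injective _ _ h1).symm
    exact ⟨⟨(g₁, g₂), Units.ext hdet⟩, Subtype.ext hA⟩
  · rintro ⟨g, hg⟩
    rw [← BasedBalancedPair.tensor_smul] at hg
    obtain ⟨α, β, -, -, h⟩ := BasedBalancedPair.equiv_of_tensor_eq hg
    exact ⟨α, β, h⟩

/-! ### The two bijections -/

/-- Based balanced pairs are tensors. -/
def basedEquiv (f : Form n) (hf : f ≠ 0) : BasedBalancedPairs.{u} f hf ≃ TensorOfDet f where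
  toFun := Quotient.lift BasedBalancedPair.tensor fun _ _ => BasedBalancedPair.tensor_eq_of_equiv
  invFun A := ⟦tensorPair hf A⟧
  left_inv := by
    rintro ⟨P⟩
    exact Quotient.sound (BasedBalancedPair.equiv_of_tensor_eq (tensor_tensorPair hf P.tensor))
  right_inv A := tensor_tensorPair hf A

/-- The isomorphism class of balanced pairs of a class of tensors. -/
def classToPair (f : Form n) (hf : f ≠ 0) : TensorClasses f → BalancedPairClasses.{u} f hf :=
  Quotient.lift (s := MulAction.orbitRel (G n) (TensorOfDet f))
    (fun A => ⟦(tensorPair.{u} hf A).toBalancedPair⟧) <| by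
    rintro A B ⟨g, hg⟩
    refine (Quotient.sound (BasedBalancedPair.toBalancedPair_equiv_iff.2 ⟨g, ?_⟩)).symm
    rw [tensor_tensorPair, tensor_tensorPair]
    exact hg

theorem classToPair_tensor (P : BasedBalancedPair.{u} f hf) :
    classToPair.{u} f hf P.tensor.toClass = ⟦P.toBalancedPair⟧ :=
  Quotient.sound (BasedBalancedPair.toBalancedPair_equiv_iff.2
    ⟨1, by rw [one_smul, tensor_tensorPair]⟩)

/-- Injectivity is the comparison of isomorphisms with `G`-orbits. Surjectivity holds because every
balanced pair admits bases with determinant exactly `f`. -/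
theorem classToPair_bijective (hn : 0 < n) (f : Form n) (hf : f ≠ 0) :
    Function.Bijective (classToPair.{u} f hf) := by
  constructor
  · rintro ⟨A⟩ ⟨B⟩ h
    obtain ⟨g, hg⟩ := BasedBalancedPair.toBalancedPair_equiv_iff.1 (Quotient.exact h)
    rw [tensor_tensorPair, tensor_tensorPair] at hg
    exact (Quotient.sound (s := MulAction.orbitRel (G n) (TensorOfDet f)) ⟨g, hg⟩).symm
  · rintro ⟨P⟩
    obtain ⟨Q, rfl⟩ := P.exists_based hn
    exact ⟨_, classToPair_tensor Q⟩

end BinForm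
end

open BinForm in
theorem theorem3p1 (n : ℕ) (hn : 0 < n) (f : Form n) (hf : f ≠ 0) :
    ∃ Φ : BasedBalancedPairs.{u} f hf ≃ TensorOfDet f,
      -- the bijection is given by the matrices of `M ⊗ N → I_f → ℤ²`
      (∀ P : BasedBalancedPair.{u} f hf, Φ ⟦P⟧ = P.tensor) ∧
      -- it is equivariant for `G`, which acts on the bases of `M` and `N`
      (∀ (g : G n) (P : BasedBalancedPair.{u} f hf), Φ ⟦g • P⟧ = g • Φ ⟦P⟧) ∧
      -- it induces a bijection on classes
      ∃ Ψ : BalancedPairClasses.{u} f hf ≃ TensorClasses f,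
        ∀ P : BasedBalancedPair.{u} f hf, Ψ ⟦P.toBalancedPair⟧ = (Φ ⟦P⟧).toClass := by
  refine ⟨basedEquiv f hf, fun _ => rfl, fun g P => P.tensor_smul g,
    (Equiv.ofBijective _ (classToPair_bijective hn f hf)).symm, fun P => ?_⟩
  rw [Equiv.symm_apply_eq]
  exact (classToPair_tensor P).symm
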